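/- Supermanifolds are real and smooth: an $n|m$-dimensional supermanifold has a Hausdorff, second countable underlying space and is glued from superdomains in $\mathbb R^{n|m}$ by parity-preserving changes of coordinates; it is compact if its underlying space is, and it is an ordinary manifold exactly if $m=0$. For an even symplectic form $\omega$ (an even, closed, nondegenerate $2$-form) with components $\omega_{AB}=\omega(\partial_A,\partial_B)$ in local coordinates $(x|\xi)$, the Liouville volume element is $dV=\sqrt{|\operatorname{Ber}(\omega_{AB})|}\,D(x|\xi)$, where $|\cdot|$ is multiplication by the sign of the body. The Liouville volume of a compact even symplectic supermanifold, with an oriented atlas (both diagonal blocks of all Jacobi matrices have positive determinant modulo nilpotents), is the Berezin integral $\int dV$, computed with a partition of unity; the Berezin integral is normalised by $\int D(\xi^1,\dots,\xi^m)\,\xi^m\cdots\xi^1=1$. Let $\mathbf{CP}^{1|1}=(\mathbb C^{2|1}\setminus\{0\})/\mathbb C^*$ with homogeneous coordinates $z^0,z^1\,|\,\zeta$; it is covered by the two affine charts $w=z^1/z^0,\ \theta=\zeta/z^0$ and $w'=z^0/z^1=1/w,\ \theta'=\zeta/z^1=\theta/w$. Here $w=x+iy$, $\theta=\xi+i\eta$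 with real coordinates $x,y\,|\,\xi,\eta$, and similarly in the second chart. For $R>0$ let $\mathbf{CP}^{1|1}_R$ be $\mathbf{CP}^{1|1}$ with the Fubini–Study form $$\omega=\tfrac i2R^2\,\partial\bar\partial\ln N,\qquad N=1+w\bar w+i\theta\bar\theta=1+x^2+y^2+2\xi\eta,$$ given by the same formula in the second chart. **Claim.** $\mathbf{CP}^{1|1}$ is a compact oriented supermanifold of real dimension $2|2$ (so it is not an ordinary manifold). For every $R>0$ the Fubini–Study form is a well-defined even symplectic form on it, the body of its Berezinian is positive, and $$\operatorname{vol}(\mathbf{CP}^{1|1}_R)=2\pi\neq0 .$$ Consequently the assertion that every compact even symplectic supermanifold which is not an ordinary manifold has Liouville volume $0$ is false. -/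

import Mathlib

open scoped ContDiff LinearAlgebra.Projectivization

noncomputable section

namespace Supergeometry

/-! ### The Grassmann algebra `Λ(ℝᵐ)` -/

/-- The real Grassmann algebra on `m` odd generators. -/
abbrev Grassmann (m : ℕ) : Type := ExteriorAlgebra ℝ (Fin m → ℝ)

variable {n m n' m' : ℕ}

/-- The odd generator `ξ^μ`. -/
def odd (μ : Fin m) : Grassmann m := ExteriorAlgebra.ι ℝ (Pi.single μ 1)

/-- The real number `r` as an element of the Grassmann algebra. -/
def const (r : ℝ) : Grassmann m := algebraMap ℝ (Grassmann m) r

/-- The basis of monomials: `monomial I` is the product of the `ξ^μ`, `μ ∈ I`, in increasing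
order. -/
def monomial : Module.Basis (Finset (Fin m)) ℝ (Grassmann m) :=
  (Pi.basisFun ℝ (Fin m)).ExteriorAlgebra

/-- The coefficient of `monomial I`. -/
def coeff (I : Finset (Fin m)) : Grassmann m →ₗ[ℝ] ℝ := monomial.coord I

/-- The body: the value after setting all odd generators to zero. -/
def body : Grassmann m →ₐ[ℝ] ℝ := ExteriorAlgebra.algebraMapInv

/-- The nilpotent part. -/
def soul (a : Grassmann m) : Grassmann m := a - const (body a)

/-- `a` is homogeneous of parity `p` modulo 2 (zero is homogeneous of both parities). -/
def HasParity (p : ℕ) (a : Grassmann m) : Prop :=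
  a ∈ CliffordAlgebra.evenOdd (0 : QuadraticForm ℝ (Fin m → ℝ)) (p : ZMod 2)

/-- The left derivative `∂/∂ξ^μ`, i.e. the odd derivation with `ξ^ν ↦ δ^ν_μ`. -/
def oddDeriv (μ : Fin m) : Grassmann m →ₗ[ℝ] Grassmann m :=
  CliffordAlgebra.contractLeft (Q := (0 : QuadraticForm ℝ (Fin m → ℝ))) (LinearMap.proj μ)

/-- The value `f(a)` of a real function `f`, smooth near the body of `a`, at an even element `a`:
the (finite) Taylor expansion of `f` around the body. -/
def applyFun (f : ℝ → ℝ) (a : Grassmann m) : Grassmann m :=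
  ∑ k ∈ Finset.range (m + 1), ((k.factorial : ℝ)⁻¹ * iteratedDeriv k f (body a)) • soul a ^ k

/-- The Berezin integral over the odd variables `D(ξ¹,…,ξᵐ)`, normalised by
`∫ D(ξ¹,…,ξᵐ) ξᵐ⋯ξ¹ = 1`; reversing the order of `m` odd factors costs
the sign `(-1)^(m(m-1)/2)`. -/
def berezin (a : Grassmann m) : ℝ := (-1) ^ (m * (m - 1) / 2) * coeff Finset.univ a

/-! ### The Berezinian -/

/-- The determinant by the Leibniz formula. It is used only for matrices of even elements, which
commute with each other. -/
def evenDet {k : ℕ} (J : Matrix (Fin k) (Fin k) (Grassmann m)) : Grassmann m :=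
  ∑ σ : Equiv.Perm (Fin k), (Equiv.Perm.sign σ : ℤ) • (List.ofFn fun i => J (σ i) i).prod

/-- The Berezinian `det (J₀₀ - J₀₁ J₁₁⁻¹ J₁₀) / det J₁₁` of an invertible even block matrix. -/
def ber (J : Matrix (Fin n ⊕ Fin m) (Fin n ⊕ Fin m) (Grassmann m')) : Grassmann m' :=
  evenDet (J.toBlocks₁₁ - J.toBlocks₁₂ * Ring.inverse J.toBlocks₂₂ * J.toBlocks₂₁) *
    Ring.inverse (evenDet J.toBlocks₂₂)

/-! ### Superdomains in `ℝ^{n|m}`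

A superfunction on an open set `U ⊆ ℝⁿ` is a smooth map `U → Λ(ℝᵐ)`; it is given by a map on all
of `ℝⁿ` whose values outside `U` are irrelevant. The coordinates of `ℝ^{n|m}` are indexed by
`Fin n ⊕ Fin m`, with `n` even coordinates followed by `m` odd ones. -/

/-- The parity of a coordinate. -/
def par : Fin n ⊕ Fin m → ℕ := Sum.elim (fun _ => 0) (fun _ => 1)

/-- Smooth superfunctions. -/
def SmoothOn (f : (Fin n → ℝ) → Grassmann m) (U : Set (Fin n → ℝ)) : Prop :=
  ∀ I, ContDiffOn ℝ ∞ (fun x => coeff I (f x)) U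

/-- The coordinate superfunctions. -/
def coordFun : Fin n ⊕ Fin m → (Fin n → ℝ) → Grassmann m :=
  Sum.elim (fun a x => const (x a)) (fun μ _ => odd μ)

/-- The partial derivative along a coordinate (a left derivative for the odd coordinates). -/
def pderiv : Fin n ⊕ Fin m → ((Fin n → ℝ) → Grassmann m) → (Fin n → ℝ) → Grassmann m
  | .inl a, f, x => ∑ I, fderiv ℝ (fun y => coeff I (f y)) x (Pi.single a 1) • monomial I
  | .inr μ, f, x => oddDeriv μ (f x)

/-- The map of underlying domains of the morphism of superdomains `ℝ^{n'|m'} ⇢ ℝ^{n|m}` in which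
the coordinates of the target are the superfunctions `φ A`. -/
def bodyMap (φ : Fin n ⊕ Fin m → (Fin n' → ℝ) → Grassmann m') (x : Fin n' → ℝ) : Fin n → ℝ :=
  fun a => body (φ (.inl a) x)

/-- The pullback of a superfunction `f = ∑ f_I ξ^I` along the morphism with coordinate
superfunctions `φ A`: substitution of `φ` into `f`, where the smooth functions `f_I` are evaluated
at the even elements `φ a` by their (finite) Taylor expansion around the bodies. -/
def pullback (φ : Fin n ⊕ Fin m → (Fin n' → ℝ) → Grassmann m')
    (f : (Fin n → ℝ) → Grassmann m) (x : Fin n' → ℝ) : Grassmann m' :=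
  ∑ I : Finset (Fin m),
    (∑ k ∈ Finset.range (m' + 1), (k.factorial : ℝ)⁻¹ • ∑ a : Fin k → Fin n,
      iteratedFDeriv ℝ k (fun y => coeff I (f y)) (bodyMap φ x) (fun j => Pi.single (a j) 1) •
        (List.ofFn fun j => soul (φ (.inl (a j)) x)).prod) *
    ((I.sort (· ≤ ·)).map fun μ => φ (.inr μ) x).prod

/-- The Jacobi matrix `∂x^A/∂x^{A'}` (row index `A'`, column index `A`). -/
def jacobian (φ : Fin n ⊕ Fin m → (Fin n → ℝ) → Grassmann m) (x : Fin n → ℝ) :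
    Matrix (Fin n ⊕ Fin m) (Fin n ⊕ Fin m) (Grassmann m) :=
  Matrix.of fun A' A => pderiv A' (φ A) x

/-! ### Supermanifolds -/

/-- The data of an atlas of a supermanifold of dimension `n|m` with underlying space `M`: for each
chart `i` a domain in `ℝⁿ` and a parametrisation of a part of `M`, and for any two charts
the coordinates of chart `j` as superfunctions `trans i j A` of the coordinates of chart `i`. -/
structure SuperAtlas (n m : ℕ) (M ι : Type) where
  dom : ι → Set (Fin n → ℝ)
  param : ι → (Fin n → ℝ) → M
  trans : ι → ι → Fin n ⊕ Fin m → (Fin n → ℝ) → Grassmann m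

namespace SuperAtlas

variable {M ι : Type} (S : SuperAtlas n m M ι)

/-- The overlap of charts `i` and `j`, seen in chart `i`. -/
def overlap (i j : ι) : Set (Fin n → ℝ) := S.dom i ∩ S.param i ⁻¹' (S.param j '' S.dom j)

/-- The laws of a (real smooth) supermanifold. -/
structure IsSupermanifold [TopologicalSpace M] : Prop where
  t2 : T2Space M
  secondCountable : SecondCountableTopology M
  isOpen_dom : ∀ i, IsOpen (S.dom i)
  isOpenEmbedding : ∀ i, Topology.IsOpenEmbedding ((S.dom i).domRestrict (S.param i))
  cover : ∀ p, ∃ i, p ∈ S.param i '' S.dom i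
  smooth : ∀ i j A, SmoothOn (S.trans i j A) (S.overlap i j)
  parity : ∀ i j A, ∀ x ∈ S.overlap i j, HasParity (par A) (S.trans i j A x)
  body_mem : ∀ i j, ∀ x ∈ S.overlap i j, bodyMap (S.trans i j) x ∈ S.dom j
  body_eq : ∀ i j, ∀ x ∈ S.overlap i j, S.param j (bodyMap (S.trans i j) x) = S.param i x
  refl : ∀ i A, ∀ x ∈ S.dom i, S.trans i i A x = coordFun A x
  cocycle : ∀ i j k A, ∀ x ∈ S.overlap i j ∩ S.overlap i k,
    S.trans i k A x = pullback (S.trans i j) (S.trans j k A) x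

/-- The atlas is oriented: the Jacobi matrices of all coordinate changes have both diagonal blocks
of positive determinant (at the level of bodies). -/
def IsOriented : Prop :=
  ∀ i j, ∀ x ∈ S.overlap i j,
    0 < ((jacobian (S.trans i j) x).map body).toBlocks₁₁.det ∧
    0 < ((jacobian (S.trans i j) x).map body).toBlocks₂₂.det

/-- A global even superfunction, given by its expressions in all charts. -/
structure IsEvenFunction (f : ι → (Fin n → ℝ) → Grassmann m) : Prop where
  smooth : ∀ i, SmoothOn (f i) (S.dom i)
  even : ∀ i, ∀ x ∈ S.dom i, HasParity 0 (f i x)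
  compat : ∀ i j, ∀ x ∈ S.overlap i j, f i x = pullback (S.trans i j) (f j) x

/-- An even symplectic structure, given in each chart by the components
`Ω_{AB} = Ω(∂_A, ∂_B)`. -/
structure IsSymplectic
    (Ω : ι → (Fin n → ℝ) → Matrix (Fin n ⊕ Fin m) (Fin n ⊕ Fin m) (Grassmann m)) : Prop where
  smooth : ∀ i A B, SmoothOn (fun x => Ω i x A B) (S.dom i)
  /-- The form is even. -/
  even : ∀ i A B, ∀ x ∈ S.dom i, HasParity (par A + par B) (Ω i x A B)
  /-- The components are those of one covariant tensor. -/
  compat : ∀ i j A' B', ∀ x ∈ S.overlap i j,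
    Ω i x A' B' = ∑ A, ∑ B, (-1 : ℝ) ^ (par B * (par B' + 1)) •
      (jacobian (S.trans i j) x A' A * pullback (S.trans i j) (fun y => Ω j y A B) x *
        jacobian (S.trans i j) x B' B)
  /-- The form is antisymmetric in the super sense, i.e. it is a 2-form. -/
  antisymm : ∀ i A B, ∀ x ∈ S.dom i,
    Ω i x A B = -((-1 : ℝ) ^ (par A * par B) • Ω i x B A)
  /-- The form is closed: `dΩ(∂_A, ∂_B, ∂_C) = 0`. -/
  closed : ∀ i A B C, ∀ x ∈ S.dom i,
    pderiv A (fun y => Ω i y B C) x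
      - (-1 : ℝ) ^ (par A * par B) • pderiv B (fun y => Ω i y A C) x
      + (-1 : ℝ) ^ (par C * (par A + par B)) • pderiv C (fun y => Ω i y A B) x = 0
  /-- The form is nondegenerate on each tangent space of the supermanifold. -/
  nondegenerate : ∀ i, ∀ x ∈ S.dom i, ((Ω i x).map body).det ≠ 0

/-- A partition of unity by even superfunctions subordinate to the atlas: the support of `ρ k` is a
compact subset of the `k`-th chart. -/
structure IsPartitionOfUnity [Fintype ι] (ρ : ι → ι → (Fin n → ℝ) → Grassmann m) : Prop where
  isEvenFunction : ∀ k, S.IsEvenFunction (ρ k)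
  support : ∀ k, ∃ K ⊆ S.dom k, IsCompact K ∧
    ∀ i, ∀ x ∈ S.dom i, S.param i x ∉ S.param k '' K → ρ k i x = 0
  sum_eq_one : ∀ i, ∀ x ∈ S.dom i, ∑ k, ρ k i x = 1

/-- The coefficient `√|Ber Ω_{AB}|` of the Liouville volume element `dV = √|Ber Ω_{AB}| D(x|ξ)` (the
absolute value means multiplication by the sign of the body, so that it does nothing when
the body of the Berezinian is positive). -/
def liouvilleDensity
    (Ω : ι → (Fin n → ℝ) → Matrix (Fin n ⊕ Fin m) (Fin n ⊕ Fin m) (Grassmann m))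
    (i : ι) (x : Fin n → ℝ) : Grassmann m :=
  applyFun (fun t => Real.sqrt |t|) (ber (Ω i x))

/-- The total Liouville volume `∫ dV` is `v`: partitions of unity subordinate to the atlas exist,
and with each of them the sum of the Berezin integrals `∫ D(x|ξ) ρ_k √|Ber Ω|` over the charts
is `v`. -/
def HasLiouvilleVolume [Fintype ι]
    (Ω : ι → (Fin n → ℝ) → Matrix (Fin n ⊕ Fin m) (Fin n ⊕ Fin m) (Grassmann m)) (v : ℝ) : Prop :=
  (∃ ρ, S.IsPartitionOfUnity ρ) ∧
    ∀ ρ, S.IsPartitionOfUnity ρ →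
      ∑ k, ∫ x in S.dom k, berezin (ρ k k x * liouvilleDensity Ω k x) = v

end SuperAtlas

/-- The assertion that every compact even symplectic supermanifold which is not an ordinary manifold
(that is, has odd dimension `m > 0`) has vanishing Liouville volume. -/
def LiouvilleVolumesVanish : Prop :=
  ∀ (n m : ℕ) (M ι : Type) [TopologicalSpace M] [CompactSpace M] [Fintype ι]
    (S : SuperAtlas n m M ι)
    (Ω : ι → (Fin n → ℝ) → Matrix (Fin n ⊕ Fin m) (Fin n ⊕ Fin m) (Grassmann m)) (v : ℝ),
    0 < m → S.IsSupermanifold → S.IsOriented → S.IsSymplectic Ω → S.HasLiouvilleVolume Ω v → v = 0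

/-! ### The complex projective superspace `CP^{1|1}` -/

/-- The underlying space of `CP^{1|1}`: the complex projective line. -/
abbrev CP1 : Type := ℙ ℂ (Fin 2 → ℂ)

/-- The projective line has the quotient topology from `ℂ² \ {0}`. -/
instance : TopologicalSpace CP1 :=
  inferInstanceAs (TopologicalSpace (Quotient (projectivizationSetoid ℂ (Fin 2 → ℂ))))

/-- The complex number with real coordinates `x`. -/
def toComplex (x : Fin 2 → ℝ) : ℂ := ⟨x 0, x 1⟩

/-- The point `[1 : w]` for chart `0` and `[w : 1]` for chart `1`. -/
def cpParam (i : Fin 2) (x : Fin 2 → ℝ) : CP1 :=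
  Projectivization.mk ℂ (Function.update (fun _ => toComplex x) i 1)
    fun h => one_ne_zero (α := ℂ) (by simpa using congrFun h i)

/-- The supermanifold `CP^{1|1} = (ℂ^{2|1} \ {0})/ℂ^*`, of real dimension `2|2`. With homogeneous
coordinates `z⁰, z¹ | ζ`, the chart `0` has the coordinates `w = z¹/z⁰, θ = ζ/z⁰` and the chart `1`
has `w' = z⁰/z¹ = 1/w, θ' = ζ/z¹ = θ/w`, where `w = x + i y` and `θ = ξ + i η`. -/
def CP11 : SuperAtlas 2 2 CP1 (Fin 2) where
  dom _ := Set.univ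
  param := cpParam
  trans i j A x :=
    if i = j then coordFun A x
    else
      match A with
      | .inl 0 => const (toComplex x)⁻¹.re
      | .inl 1 => const (toComplex x)⁻¹.im
      | .inr 0 => (toComplex x)⁻¹.re • odd 0 - (toComplex x)⁻¹.im • odd 1
      | .inr 1 => (toComplex x)⁻¹.im • odd 0 + (toComplex x)⁻¹.re • odd 1

/-- The superfunction `N = 1 + w w̄ + i θ θ̄ = 1 + x² + y² + 2 ξ η` on each of the two charts. -/
def cpN (x : Fin 2 → ℝ) : Grassmann 2 :=
  const (1 + x 0 ^ 2 + x 1 ^ 2) + (2 : ℝ) • (odd 0 * odd 1)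

/-- The Kähler potential `R² ln N`. -/
def cpPotential (R : ℝ) (x : Fin 2 → ℝ) : Grassmann 2 :=
  R ^ 2 • applyFun Real.log (cpN x)

/-- The components of `d^c K = i(∂̄ - ∂)K`:
`(d^c K)_x = -K_y, (d^c K)_y = K_x, (d^c K)_ξ = -K_η, (d^c K)_η = K_ξ`. -/
def dc (K : (Fin 2 → ℝ) → Grassmann 2) : Fin 2 ⊕ Fin 2 → (Fin 2 → ℝ) → Grassmann 2
  | .inl 0, x => -pderiv (.inl 1) K x
  | .inl 1, x => pderiv (.inl 0) K x
  | .inr 0, x => -pderiv (.inr 1) K x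
  | .inr 1, x => pderiv (.inr 0) K x

/-- The components `(dα)_{AB} = ∂_A α_B - (-1)^{AB} ∂_B α_A` of the exterior derivative of an even
1-form with components `α_A = α(∂_A)`. -/
def extDeriv (α : Fin n ⊕ Fin m → (Fin n → ℝ) → Grassmann m) (x : Fin n → ℝ) :
    Matrix (Fin n ⊕ Fin m) (Fin n ⊕ Fin m) (Grassmann m) :=
  Matrix.of fun A B =>
    pderiv A (α B) x - (-1 : ℝ) ^ (par A * par B) • pderiv B (α A) x

/-- The Fubini–Study form of `CP^{1|1}_R`, `ω = (i/2) R² ∂∂̄ ln N = (1/4) d d^c (R² ln N)`. -/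
def fubiniStudy (R : ℝ) (_ : Fin 2) (x : Fin 2 → ℝ) :
    Matrix (Fin 2 ⊕ Fin 2) (Fin 2 ⊕ Fin 2) (Grassmann 2) :=
  (1 / 4 : ℝ) • extDeriv (dc (cpPotential R)) x

end Supergeometry

end

open Supergeometry

namespace Supergeometry

open Matrix

/-! ### Grassmann algebras -/

/-! Write `q = 1/(1 + x² + y²)` (`fsWeight`) and `w' = 1/w`. With two odd generators every
superfunction is `a + bξ + cη + dξη` (`gr`), so all superalgebra reduces to identities between real
coefficients.

In either chart the Berezinian of the form is `q² - 4q³ ξη` (`ber_fubiniStudy`): in dimension 2|2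
the factors `R⁴` of numerator and denominator cancel, which is why the volume does not depend on
`R`. Its square root is `q - 2q² ξη`. As `ξη = -ηξ`, the Berezin integral over the odd variables
leaves `2q²`, whose integral over the plane is `2π` (`integral_fsWeight_sq`).

One chart misses only a point, but Berezin integrals without compact support need not be coordinate
independent, so the partition of unity must be treated honestly. The coordinate change `w' = 1/w`,
`θ' = w'θ` has even part free of nilpotents. Hence pullback involves no Taylor corrections, and the
integrand of any superfunction acquires exactly the factor `|w'|⁴`, the Jacobian determinant of
inversion (`liouvilleIntegrand_pullback`, `integrable_and_integral_inversion`). The contribution of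
chart 1 therefore moves to chart 0, where the partition sums to 1.

The form is closed because `d² = 0` (`extDeriv_closed`), and nondegenerate because its body is block
diagonal with invertible blocks. That the two charts define the same form is checked on components
(`fubiniStudy_compat`). -/

theorem monomial_eq_prod {m : ℕ} (I : Finset (Fin m)) :
    (monomial I : Grassmann m) = ((I.sort (· ≤ ·)).map odd).prod := by
  unfold monomial
  rw [ExteriorAlgebra.basis_apply_ofCard _ (n := (I.sort (· ≤ ·)).length) (by simp)]
  rw [ExteriorAlgebra.ιMulti_family, ExteriorAlgebra.ιMulti_apply]
  congr 1
  apply List.ext_getElem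
  · simp
  · intro i h1 h2
    simp [odd, Set.powersetCard.ofFinEmbEquiv_symm_apply, Finset.orderEmbOfFin_apply]

theorem odd_mul_self {m : ℕ} (μ : Fin m) : (odd μ * odd μ : Grassmann m) = 0 :=
  ExteriorAlgebra.ι_sq_zero _

theorem odd_mul_odd {m : ℕ} (μ ν : Fin m) : (odd μ * odd ν : Grassmann m) = -(odd ν * odd μ) :=
  eq_neg_of_add_eq_zero_left (ExteriorAlgebra.ι_add_mul_swap _ _)

@[simp] theorem body_const {m : ℕ} (r : ℝ) : body (const r : Grassmann m) = r :=
  ExteriorAlgebra.algebraMap_leftInverse _ r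

@[simp] theorem body_odd {m : ℕ} (μ : Fin m) : body (odd μ : Grassmann m) = 0 := by
  simp [body, odd, ExteriorAlgebra.algebraMapInv]

@[simp] theorem soul_const {m : ℕ} (r : ℝ) : soul (const r : Grassmann m) = 0 := by
  simp [soul]

@[simp] theorem oddDeriv_const {m : ℕ} (μ : Fin m) (r : ℝ) :
    oddDeriv μ (const r : Grassmann m) = 0 :=
  CliffordAlgebra.contractLeft_algebraMap (Q := (0 : QuadraticForm ℝ (Fin m → ℝ))) _ _

theorem oddDeriv_odd_mul {m : ℕ} (μ ν : Fin m) (a : Grassmann m) :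
    oddDeriv μ (odd ν * a) = (if μ = ν then 1 else 0 : ℝ) • a - odd ν * oddDeriv μ a := by
  have h := CliffordAlgebra.contractLeft_ι_mul (Q := (0 : QuadraticForm ℝ (Fin m → ℝ)))
    (LinearMap.proj μ) (Pi.single ν 1) a
  simp only [LinearMap.proj_apply, Pi.single_apply] at h
  exact h

theorem oddDeriv_odd {m : ℕ} (μ ν : Fin m) :
    oddDeriv μ (odd ν : Grassmann m) = const (if μ = ν then 1 else 0) := by
  have h := oddDeriv_odd_mul μ ν (const 1)
  rw [oddDeriv_const, const, map_one, mul_one, mul_zero, sub_zero] at h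
  rw [h, const, Algebra.algebraMap_eq_smul_one]

/-- The element `a + b ξ + c η + d ξ η` of the Grassmann algebra on two generators. -/
noncomputable def gr (a b c d : ℝ) : Grassmann 2 :=
  const a + b • odd 0 + c • odd 1 + d • (odd 0 * odd 1)

theorem const_eq_gr (r : ℝ) : const r = gr r 0 0 0 := by simp [gr]

theorem odd_zero_eq_gr : odd 0 = gr 0 1 0 0 := by simp [gr, const]

theorem odd_one_eq_gr : odd 1 = gr 0 0 1 0 := by simp [gr, const]

theorem one_eq_gr : (1 : Grassmann 2) = gr 1 0 0 0 := by simp [gr, const]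

theorem zero_eq_gr : (0 : Grassmann 2) = gr 0 0 0 0 := by simp [gr, const]

theorem gr_add (a b c d a' b' c' d' : ℝ) :
    gr a b c d + gr a' b' c' d' = gr (a + a') (b + b') (c + c') (d + d') := by
  simp only [gr, const, map_add, add_smul]
  abel

theorem gr_smul (r a b c d : ℝ) : r • gr a b c d = gr (r * a) (r * b) (r * c) (r * d) := by
  simp only [gr, const, map_mul, Algebra.smul_def, mul_assoc, mul_add]

theorem gr_neg (a b c d : ℝ) : -gr a b c d = gr (-a) (-b) (-c) (-d) := by
  rw [← neg_one_smul ℝ, gr_smul]; simp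

theorem gr_sub (a b c d a' b' c' d' : ℝ) :
    gr a b c d - gr a' b' c' d' = gr (a - a') (b - b') (c - c') (d - d') := by
  simp only [sub_eq_add_neg, gr_neg, gr_add]

theorem gr_mul (a b c d a' b' c' d' : ℝ) :
    gr a b c d * gr a' b' c' d' =
      gr (a * a') (a * b' + b * a') (a * c' + c * a') (a * d' + d * a' + b * c' - c * b') := by
  have h0 := odd_mul_self (0 : Fin 2)
  have h1 := odd_mul_self (1 : Fin 2)
  have h2 := odd_mul_odd (1 : Fin 2) 0
  have h3 : (odd 0 * (odd 0 * odd 1) : Grassmann 2) = 0 := by rw [← mul_assoc, h0, zero_mul]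
  have h4 : (odd 1 * (odd 0 * odd 1) : Grassmann 2) = 0 := by
    rw [← mul_assoc, h2, neg_mul, mul_assoc, h1, mul_zero, neg_zero]
  have h5 : (odd 0 * odd 1 * odd 0 : Grassmann 2) = 0 := by
    rw [mul_assoc, h2, mul_neg, h3, neg_zero]
  have h6 : (odd 0 * odd 1 * odd 1 : Grassmann 2) = 0 := by rw [mul_assoc, h1, mul_zero]
  have h7 : (odd 0 * odd 1 * (odd 0 * odd 1) : Grassmann 2) = 0 := by
    rw [mul_assoc, h4, mul_zero]
  simp only [gr, const, Algebra.algebraMap_eq_smul_one, add_mul, mul_add, smul_mul_smul_comm,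
    one_mul, mul_one, h0, h1, h2, h3, h4, h5, h6, h7, smul_zero, add_zero, smul_neg]
  module

theorem sort_pair : ({0, 1} : Finset (Fin 2)).sort (· ≤ ·) = [0, 1] := by
  rw [Finset.sort_insert] <;> simp

theorem monomial_empty_eq_gr : monomial ∅ = gr 1 0 0 0 := by
  rw [monomial_eq_prod]; simp [one_eq_gr]

theorem monomial_zero_eq_gr : monomial {0} = gr 0 1 0 0 := by
  rw [monomial_eq_prod]; simp [odd_zero_eq_gr]

theorem monomial_one_eq_gr : monomial {1} = gr 0 0 1 0 := by
  rw [monomial_eq_prod]; simp [odd_one_eq_gr]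

theorem monomial_pair_eq_gr : monomial {0, 1} = gr 0 0 0 1 := by
  rw [monomial_eq_prod, sort_pair]; simp [odd_one_eq_gr, odd_zero_eq_gr, gr_mul]

theorem gr_eq_monomials (a b c d : ℝ) : gr a b c d =
    a • monomial ∅ + b • monomial {0} + c • monomial {1} + d • monomial {0, 1} := by
  simp [monomial_empty_eq_gr, monomial_zero_eq_gr, monomial_one_eq_gr, monomial_pair_eq_gr,
    gr_smul, gr_add]

@[simp] theorem coeff_empty_gr (a b c d : ℝ) : coeff ∅ (gr a b c d) = a := by
  rw [gr_eq_monomials]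
  simp [coeff]

@[simp] theorem coeff_zero_gr (a b c d : ℝ) : coeff {0} (gr a b c d) = b := by
  rw [gr_eq_monomials]
  simp [coeff, show ({0, 1} : Finset (Fin 2)) ≠ {0} by decide]

@[simp] theorem coeff_one_gr (a b c d : ℝ) : coeff {1} (gr a b c d) = c := by
  rw [gr_eq_monomials]
  simp [coeff, show ({0, 1} : Finset (Fin 2)) ≠ {1} by decide]

@[simp] theorem coeff_pair_gr (a b c d : ℝ) : coeff {0, 1} (gr a b c d) = d := by
  rw [gr_eq_monomials]
  simp [coeff, show ({0} : Finset (Fin 2)) ≠ {0, 1} by decide]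

theorem sum_finset_fin_two {α : Type*} [AddCommMonoid α] (f : Finset (Fin 2) → α) :
    ∑ I, f I = f ∅ + f {0} + f {1} + f {0, 1} := by
  rw [show (Finset.univ : Finset (Finset (Fin 2))) = {∅, {0}, {1}, {0, 1}} by decide,
    Finset.sum_insert (by decide), Finset.sum_insert (by decide), Finset.sum_insert (by decide),
    Finset.sum_singleton]
  simp only [add_assoc]

/-- This lets an unknown superfunction, such as a member of an arbitrary partition of unity, enter
the coefficient calculus. -/
theorem eq_gr_coeff (a : Grassmann 2) :
    a = gr (coeff ∅ a) (coeff {0} a) (coeff {1} a) (coeff {0, 1} a) := by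
  rw [gr_eq_monomials, ← sum_finset_fin_two fun I => coeff I a • monomial I]
  exact (monomial.sum_repr a).symm

@[simp] theorem body_gr (a b c d : ℝ) : body (gr a b c d) = a := by
  simp [gr]

theorem soul_gr (a b c d : ℝ) : soul (gr a b c d) = gr 0 b c d := by
  simp [soul, const_eq_gr, gr_sub]

/-- The sign comes from the normalisation on `ηξ = -ξη`. -/
theorem berezin_gr (a b c d : ℝ) : berezin (gr a b c d) = -d := by
  rw [berezin, show (Finset.univ : Finset (Fin 2)) = {0, 1} by decide, coeff_pair_gr]
  norm_num

theorem oddDeriv_zero_gr (a b c d : ℝ) : oddDeriv 0 (gr a b c d) = gr b 0 d 0 := by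
  rw [gr]
  simp only [map_add, map_smul, oddDeriv_const, oddDeriv_odd_mul, oddDeriv_odd]
  simp [const_eq_gr, zero_eq_gr, odd_zero_eq_gr, odd_one_eq_gr, gr_smul, gr_add, gr_mul, gr_sub]

/-- The sign arises because `∂/∂η` must pass `ξ` before it reaches `η`. -/
theorem oddDeriv_one_gr (a b c d : ℝ) : oddDeriv 1 (gr a b c d) = gr c (-d) 0 0 := by
  rw [gr]
  simp only [map_add, map_smul, oddDeriv_const, oddDeriv_odd_mul, oddDeriv_odd]
  simp [const_eq_gr, zero_eq_gr, odd_zero_eq_gr, odd_one_eq_gr, gr_smul, gr_add, gr_mul, gr_sub]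

theorem hasParity_zero_gr (a d : ℝ) : HasParity 0 (gr a 0 0 d) := by
  simp only [HasParity, gr, Nat.cast_zero, zero_smul, add_zero]
  refine add_mem (CliffordAlgebra.one_le_evenOdd_zero _ ?_)
    (Submodule.smul_mem _ _ (CliffordAlgebra.ι_mul_ι_mem_evenOdd_zero _ _ _))
  exact Submodule.mem_one.2 ⟨a, rfl⟩

theorem hasParity_one_gr (b c : ℝ) : HasParity 1 (gr 0 b c 0) := by
  simp only [HasParity, gr, Nat.cast_one, zero_smul, add_zero, const, map_zero, zero_add]
  exact add_mem (Submodule.smul_mem _ _ (CliffordAlgebra.ι_mem_evenOdd_one _ _))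
    (Submodule.smul_mem _ _ (CliffordAlgebra.ι_mem_evenOdd_one _ _))

theorem HasParity.add_two {m p : ℕ} {a : Grassmann m} (h : HasParity p a) :
    HasParity (p + 2) a := by
  have : ((p + 2 : ℕ) : ZMod 2) = p := by
    rw [Nat.cast_add, show ((2 : ℕ) : ZMod 2) = 0 by decide, add_zero]
  rwa [HasParity, this]

/-- The soul `dξη` squares to zero, so the Taylor expansion stops at first order. -/
theorem applyFun_gr (f : ℝ → ℝ) (a d : ℝ) :
    applyFun f (gr a 0 0 d) = gr (f a) 0 0 (deriv f a * d) := by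
  simp [applyFun, Finset.sum_range_succ, soul_gr, one_eq_gr, gr_smul, gr_add, pow_two, gr_mul]

theorem inverse_eq_of_mul_eq_one {R : Type*} [Ring R] {a b : R} (hab : a * b = 1)
    (hba : b * a = 1) : Ring.inverse a = b :=
  Ring.inverse_unit ⟨a, b, hab, hba⟩

theorem evenDet_fin_two {m : ℕ} (J : Matrix (Fin 2) (Fin 2) (Grassmann m)) :
    evenDet J = J 0 0 * J 1 1 - J 1 0 * J 0 1 := by
  rw [evenDet, show (Finset.univ : Finset (Equiv.Perm (Fin 2))) = {1, Equiv.swap 0 1} by decide,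
    Finset.sum_pair (by decide)]
  simp [sub_eq_add_neg]

/-! ### Superfunctions on `ℝ^{2|2}` and their pullbacks -/

theorem smoothOn_gr {U : Set (Fin 2 → ℝ)} {a b c d : (Fin 2 → ℝ) → ℝ}
    (ha : ContDiffOn ℝ ∞ a U) (hb : ContDiffOn ℝ ∞ b U) (hc : ContDiffOn ℝ ∞ c U)
    (hd : ContDiffOn ℝ ∞ d U) : SmoothOn (fun x => gr (a x) (b x) (c x) (d x)) U := by
  intro I
  have : I = ∅ ∨ I = {0} ∨ I = {1} ∨ I = {0, 1} := by revert I; decide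
  rcases this with rfl | rfl | rfl | rfl <;> simpa

theorem pderiv_even_gr (i : Fin 2) (a b c d : (Fin 2 → ℝ) → ℝ) (x : Fin 2 → ℝ) :
    pderiv (.inl i) (fun y => gr (a y) (b y) (c y) (d y)) x =
      gr (fderiv ℝ a x (Pi.single i 1)) (fderiv ℝ b x (Pi.single i 1))
        (fderiv ℝ c x (Pi.single i 1)) (fderiv ℝ d x (Pi.single i 1)) := by
  rw [pderiv, sum_finset_fin_two, gr_eq_monomials]
  simp

/-- Without nilpotent parts in the even coordinates, every Taylor term of positive order contains a
zero soul; only the substitution of the odd coordinates remains. -/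
theorem pullback_eq_of_even_const {n m n' m' : ℕ} {φ : Fin n ⊕ Fin m → (Fin n' → ℝ) → Grassmann m'}
    {x : Fin n' → ℝ} {y : Fin n → ℝ} (h : ∀ a, φ (.inl a) x = const (y a))
    (f : (Fin n → ℝ) → Grassmann m) :
    pullback φ f x =
      ∑ I, coeff I (f y) • ((I.sort (· ≤ ·)).map fun μ => φ (.inr μ) x).prod := by
  have hy : bodyMap φ x = y := by ext a; simp [bodyMap, h]
  refine Finset.sum_congr rfl fun I _ => ?_
  rw [Finset.sum_range_succ', Finset.sum_eq_zero]
  · simp [hy]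
  · intro k _
    rw [Finset.sum_eq_zero, smul_zero]
    intro a _
    simp [h]

theorem pullback_of_coordFun {n m : ℕ} {φ : Fin n ⊕ Fin m → (Fin n → ℝ) → Grassmann m}
    {x : Fin n → ℝ} (h : ∀ A, φ A x = coordFun A x) (f : (Fin n → ℝ) → Grassmann m) :
    pullback φ f x = f x := by
  rw [pullback_eq_of_even_const (y := x) (fun a => h _)]
  simp only [h, coordFun, Sum.elim_inr, ← monomial_eq_prod]
  exact monomial.sum_repr _

theorem pullback_gr {φ : Fin 2 ⊕ Fin 2 → (Fin 2 → ℝ) → Grassmann 2} {x y : Fin 2 → ℝ}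
    (h : ∀ a, φ (.inl a) x = const (y a)) (f : (Fin 2 → ℝ) → Grassmann 2) {a b c d : ℝ}
    (hf : f y = gr a b c d) :
    pullback φ f x =
      const a + b • φ (.inr 0) x + c • φ (.inr 1) x + d • (φ (.inr 0) x * φ (.inr 1) x) := by
  rw [pullback_eq_of_even_const h, sum_finset_fin_two, hf, sort_pair]
  simp [const, Algebra.algebraMap_eq_smul_one]

/-! ### The topology of the projective line -/

theorem isOpenQuotientMap_mk' :
    IsOpenQuotientMap (Projectivization.mk' ℂ : {v : Fin 2 → ℂ // v ≠ 0} → CP1) := by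
  refine ⟨Quotient.mk''_surjective, continuous_quotient_mk', fun U hU => ?_⟩
  refine isOpen_coinduced.2 ?_
  -- The saturation of an open set is the union of its translates by nonzero scalars, hence open.
  have : Quotient.mk'' (s₁ := projectivizationSetoid ℂ (Fin 2 → ℂ)) ⁻¹'
      (Projectivization.mk' ℂ '' U) =
      ⋃ c : ℂˣ, (fun v : {v : Fin 2 → ℂ // v ≠ 0} =>
        (⟨c • v.1, smul_ne_zero_iff_ne c |>.2 v.2⟩ : {v : Fin 2 → ℂ // v ≠ 0})) ⁻¹' U := by
    ext v
    simp only [Set.mem_preimage, Set.mem_iUnion]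
    constructor
    · rintro ⟨u, hu, h⟩
      obtain ⟨c, hc⟩ := (Projectivization.mk_eq_mk_iff ℂ u.1 v.1 u.2 v.2).1 h
      exact ⟨c, by simpa only [hc] using hu⟩
    · rintro ⟨c, hc⟩
      exact ⟨_, hc, (Projectivization.mk_eq_mk_iff ℂ _ _ _ _).2 ⟨c, rfl⟩⟩
  change IsOpen (Quotient.mk'' ⁻¹' _)
  refine this ▸ isOpen_iUnion fun c => hU.preimage ?_
  fun_prop

theorem mk_eq_mk_iff_cross {v w : Fin 2 → ℂ} (hv : v ≠ 0) (hw : w ≠ 0) :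
    (Projectivization.mk ℂ v hv : CP1) = Projectivization.mk ℂ w hw ↔ v 0 * w 1 = v 1 * w 0 := by
  rw [Projectivization.mk_eq_mk_iff']
  constructor
  · rintro ⟨a, rfl⟩
    simp only [Pi.smul_apply, smul_eq_mul]
    ring
  · intro h
    by_cases h0 : w 0 = 0
    · have h1 : w 1 ≠ 0 := fun h1 => hw (by ext i; fin_cases i <;> simp [h0, h1])
      refine ⟨v 1 / w 1, ?_⟩
      have hv0 : v 0 = 0 := by simpa [h0, h1] using h
      ext i; fin_cases i <;> simp [h0, hv0, h1]
    · refine ⟨v 0 / w 0, ?_⟩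
      ext i; fin_cases i
      · simp [h0]
      · simp; field_simp; rw [h, mul_comm]

/-- The quotient map is open, so Hausdorffness amounts to closedness of the relation, which is the
equation `v₀w₁ = v₁w₀`. -/
instance t2Space_CP1 : T2Space CP1 := by
  rw [t2Space_iff_of_isOpenQuotientMap isOpenQuotientMap_mk']
  simp only [Projectivization.mk'_eq_mk, mk_eq_mk_iff_cross]
  have h1 (i : Fin 2) : Continuous
      fun q : {v : Fin 2 → ℂ // v ≠ 0} × {v : Fin 2 → ℂ // v ≠ 0} => q.1.1 i :=
    (continuous_apply i).comp (continuous_subtype_val.comp continuous_fst)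
  have h2 (i : Fin 2) : Continuous
      fun q : {v : Fin 2 → ℂ // v ≠ 0} × {v : Fin 2 → ℂ // v ≠ 0} => q.2.1 i :=
    (continuous_apply i).comp (continuous_subtype_val.comp continuous_snd)
  exact isClosed_eq ((h1 0).mul (h2 1)) ((h1 1).mul (h2 0))

instance secondCountableTopology_CP1 : SecondCountableTopology CP1 :=
  TopologicalSpace.Quotient.secondCountableTopology isOpenQuotientMap_mk'.isOpenMap

theorem continuous_toComplex : Continuous toComplex := by
  have : toComplex = fun x => (x 0 : ℂ) + x 1 * Complex.I := by
    ext x; apply Complex.ext <;> simp [toComplex]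
  rw [this]
  fun_prop

/-- The vector with real coordinates `w`, inverse to `toComplex`. -/
def ofComplex (w : ℂ) : Fin 2 → ℝ := ![w.re, w.im]

@[simp] theorem toComplex_ofComplex (w : ℂ) : toComplex (ofComplex w) = w := rfl

@[simp] theorem ofComplex_toComplex (x : Fin 2 → ℝ) : ofComplex (toComplex x) = x := by
  ext i; fin_cases i <;> rfl

theorem continuous_ofComplex : Continuous ofComplex := by
  unfold ofComplex
  fun_prop

theorem toComplex_injective : Function.Injective toComplex :=
  Function.LeftInverse.injective ofComplex_toComplex

theorem toComplex_ne_zero {x : Fin 2 → ℝ} : toComplex x ≠ 0 ↔ x ≠ 0 :=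
  (toComplex_injective.ne_iff' (by apply Complex.ext <;> simp [toComplex]))

theorem continuous_cpParam (i : Fin 2) : Continuous (cpParam i) := by
  refine isOpenQuotientMap_mk'.continuous.comp
    (Continuous.subtype_mk (f := fun x => Function.update (fun _ => toComplex x) i 1) ?_ _)
  exact (continuous_pi fun _ => continuous_toComplex).update i continuous_const

theorem cpParam_eq_iff_same {i : Fin 2} {x y : Fin 2 → ℝ} : cpParam i x = cpParam i y ↔ x = y := by
  rw [cpParam, cpParam, mk_eq_mk_iff_cross, ← toComplex_injective.eq_iff]
  fin_cases i <;> simp [eq_comm]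

theorem cpParam_eq_iff_ne {i j : Fin 2} (h : i ≠ j) {x y : Fin 2 → ℝ} :
    cpParam i x = cpParam j y ↔ toComplex x * toComplex y = 1 := by
  rw [cpParam, cpParam, mk_eq_mk_iff_cross]
  fin_cases i <;> fin_cases j <;> simp at h ⊢
  exact eq_comm

/-- In `Fin 2`, `1 - i` is the other index, so the quotient is the affine coordinate of chart `i`.
-/
theorem mk_eq_cpParam {v : Fin 2 → ℂ} (hv : v ≠ 0) {i : Fin 2} (hi : v i ≠ 0) :
    (Projectivization.mk ℂ v hv : CP1) = cpParam i (ofComplex (v (1 - i) / v i)) := by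
  rw [cpParam, mk_eq_mk_iff_cross]
  fin_cases i <;> simp at hi ⊢ <;> field_simp

theorem mem_image_cpParam_iff {i : Fin 2} {U : Set (Fin 2 → ℝ)} {v : Fin 2 → ℂ} (hv : v ≠ 0) :
    (Projectivization.mk ℂ v hv : CP1) ∈ cpParam i '' U ↔
      v i ≠ 0 ∧ ofComplex (v (1 - i) / v i) ∈ U := by
  constructor
  · rintro ⟨x, hx, h⟩
    have hi : v i ≠ 0 := by
      intro hi
      apply hv
      rw [cpParam, mk_eq_mk_iff_cross] at h
      ext j
      fin_cases i <;> fin_cases j <;> simp_all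
    rw [mk_eq_cpParam hv hi, cpParam_eq_iff_same] at h
    exact ⟨hi, h ▸ hx⟩
  · rintro ⟨hi, h⟩
    exact ⟨_, h, (mk_eq_cpParam hv hi).symm⟩

/-- Openness of an image is tested upstairs in `ℂ² \ {0}`, where it becomes a condition on the
continuous affine coordinate on the open set where it is defined. -/
theorem isOpenEmbedding_cpParam (i : Fin 2) : Topology.IsOpenEmbedding (cpParam i) := by
  refine .of_continuous_injective_isOpenMap (continuous_cpParam i)
    (fun x y => cpParam_eq_iff_same.1) fun U hU => ?_
  rw [← isOpenQuotientMap_mk'.isQuotientMap.isOpen_preimage]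
  have : Projectivization.mk' ℂ ⁻¹' (cpParam i '' U) = {v : {v : Fin 2 → ℂ // v ≠ 0} |
      v.1 i ≠ 0 ∧ ofComplex (v.1 (1 - i) / v.1 i) ∈ U} := by
    ext v
    simp only [Set.mem_preimage, Projectivization.mk'_eq_mk, mem_image_cpParam_iff v.2]
    rfl
  rw [this]
  have hc (j : Fin 2) : Continuous fun v : {v : Fin 2 → ℂ // v ≠ 0} => v.1 j :=
    (continuous_apply j).comp continuous_subtype_val
  have ho : IsOpen {v : {v : Fin 2 → ℂ // v ≠ 0} | v.1 i ≠ 0} :=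
    isOpen_ne_fun (hc i) continuous_const
  refine ContinuousOn.isOpen_inter_preimage (t := U)
    (f := fun v : {v : Fin 2 → ℂ // v ≠ 0} => ofComplex (v.1 (1 - i) / v.1 i)) ?_ ho hU
  exact continuous_ofComplex.comp_continuousOn
    (ContinuousOn.div (hc _).continuousOn (hc _).continuousOn fun v hv => hv)

/-- Dividing by the homogeneous coordinate of larger modulus puts each point in one of the two
closed unit discs, so two compact images cover the space. -/
instance compactSpace_CP1 : CompactSpace CP1 := by
  have hK : IsCompact (ofComplex '' Metric.closedBall 0 1) :=
    (isCompact_closedBall _ _).image continuous_ofComplex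
  refine ⟨(((hK.image (continuous_cpParam 0)).union
    (hK.image (continuous_cpParam 1)))).of_isClosed_subset isClosed_univ fun p _ => ?_⟩
  induction p using Projectivization.ind with | h v hv =>
  simp only [Set.mem_union, mem_image_cpParam_iff]
  have key (i : Fin 2) (h : ‖v (1 - i)‖ ≤ ‖v i‖) :
      v i ≠ 0 ∧ ofComplex (v (1 - i) / v i) ∈ ofComplex '' Metric.closedBall 0 1 := by
    refine ⟨fun hi => hv ?_, _, ?_, rfl⟩
    · have h' : v (1 - i) = 0 := by simpa [hi] using h
      ext j
      fin_cases i <;> fin_cases j <;> simp_all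
    · simpa using div_le_one_of_le₀ h (norm_nonneg _)
  rcases le_total ‖v 1‖ ‖v 0‖ with h | h
  · exact .inl (key 0 h)
  · exact .inr (key 1 h)

/-! ### Partial derivatives of functions of two variables -/

/-- The function `f` is differentiable at `x` with partial derivatives `u` and `v`. -/
def HasGrad (f : (Fin 2 → ℝ) → ℝ) (u v : ℝ) (x : Fin 2 → ℝ) : Prop :=
  HasFDerivAt f (u • ContinuousLinearMap.proj (R := ℝ) (φ := fun _ : Fin 2 => ℝ) 0 +
    v • ContinuousLinearMap.proj (R := ℝ) (φ := fun _ : Fin 2 => ℝ) 1) x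

namespace HasGrad

variable {f g : (Fin 2 → ℝ) → ℝ} {u v u' v' : ℝ} {x : Fin 2 → ℝ}

theorem congr (h : HasGrad f u v x) (hu : u = u') (hv : v = v') : HasGrad f u' v' x :=
  hu ▸ hv ▸ h

theorem const (c : ℝ) : HasGrad (fun _ => c) 0 0 x := by
  simpa [HasGrad] using hasFDerivAt_const c x

theorem coord_zero : HasGrad (fun x => x 0) 1 0 x := by
  simpa [HasGrad] using hasFDerivAt_apply (𝕜 := ℝ) (0 : Fin 2) x

theorem coord_one : HasGrad (fun x => x 1) 0 1 x := by
  simpa [HasGrad] using hasFDerivAt_apply (𝕜 := ℝ) (1 : Fin 2) x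

theorem add (hf : HasGrad f u v x) (hg : HasGrad g u' v' x) :
    HasGrad (fun x => f x + g x) (u + u') (v + v') x := by
  refine (HasFDerivAt.fun_add hf hg).congr_fderiv ?_
  module

theorem mul (hf : HasGrad f u v x) (hg : HasGrad g u' v' x) :
    HasGrad (fun x => f x * g x) (f x * u' + g x * u) (f x * v' + g x * v) x := by
  refine (HasFDerivAt.fun_mul hf hg).congr_fderiv ?_
  module

theorem comp {φ : ℝ → ℝ} {c : ℝ} (hφ : HasDerivAt φ c (f x)) (hf : HasGrad f u v x) :
    HasGrad (fun x => φ (f x)) (c * u) (c * v) x := by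
  refine (hφ.comp_hasFDerivAt x hf).congr_fderiv ?_
  module

theorem neg (hf : HasGrad f u v x) : HasGrad (fun x => -f x) (-u) (-v) x := by
  refine (HasFDerivAt.fun_neg hf).congr_fderiv ?_
  module

theorem inv (hf : HasGrad f u v x) (h : f x ≠ 0) :
    HasGrad (fun x => (f x)⁻¹) (-(f x ^ 2)⁻¹ * u) (-(f x ^ 2)⁻¹ * v) x :=
  comp (hasDerivAt_inv h) hf

theorem fderiv_zero (h : HasGrad f u v x) : fderiv ℝ f x (Pi.single 0 1) = u := by
  rw [HasFDerivAt.fderiv h]; simp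

theorem fderiv_one (h : HasGrad f u v x) : fderiv ℝ f x (Pi.single 1 1) = v := by
  rw [HasFDerivAt.fderiv h]; simp

end HasGrad

theorem pderiv_inl_zero_gr {a b c d : (Fin 2 → ℝ) → ℝ} {a₀ a₁ b₀ b₁ c₀ c₁ d₀ d₁ : ℝ}
    {x : Fin 2 → ℝ} (ha : HasGrad a a₀ a₁ x) (hb : HasGrad b b₀ b₁ x) (hc : HasGrad c c₀ c₁ x)
    (hd : HasGrad d d₀ d₁ x) :
    pderiv (.inl 0) (fun y => gr (a y) (b y) (c y) (d y)) x = gr a₀ b₀ c₀ d₀ := by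
  rw [pderiv_even_gr, ha.fderiv_zero, hb.fderiv_zero, hc.fderiv_zero, hd.fderiv_zero]

theorem pderiv_inl_one_gr {a b c d : (Fin 2 → ℝ) → ℝ} {a₀ a₁ b₀ b₁ c₀ c₁ d₀ d₁ : ℝ}
    {x : Fin 2 → ℝ} (ha : HasGrad a a₀ a₁ x) (hb : HasGrad b b₀ b₁ x) (hc : HasGrad c c₀ c₁ x)
    (hd : HasGrad d d₀ d₁ x) :
    pderiv (.inl 1) (fun y => gr (a y) (b y) (c y) (d y)) x = gr a₁ b₁ c₁ d₁ := by
  rw [pderiv_even_gr, ha.fderiv_one, hb.fderiv_one, hc.fderiv_one, hd.fderiv_one]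

/-! ### The components of the Fubini–Study form -/

/-- The function `1 / (1 + x² + y²)`. -/
noncomputable def fsWeight (x : Fin 2 → ℝ) : ℝ := (1 + x 0 ^ 2 + x 1 ^ 2)⁻¹

theorem one_add_sq_pos (x : Fin 2 → ℝ) : 0 < 1 + x 0 ^ 2 + x 1 ^ 2 := by positivity

theorem fsWeight_pos (x : Fin 2 → ℝ) : 0 < fsWeight x := inv_pos.2 (one_add_sq_pos x)

theorem fsWeight_mul (x : Fin 2 → ℝ) : fsWeight x * (1 + x 0 ^ 2 + x 1 ^ 2) = 1 :=
  inv_mul_cancel₀ (one_add_sq_pos x).ne'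

theorem contDiff_fsWeight : ContDiff ℝ ∞ fsWeight :=
  ContDiff.inv (by fun_prop) fun x => (one_add_sq_pos x).ne'

theorem hasGrad_one_add_sq (x : Fin 2 → ℝ) :
    HasGrad (fun x => 1 + x 0 ^ 2 + x 1 ^ 2) (2 * x 0) (2 * x 1) x := by
  have h := ((HasGrad.const (x := x) 1).add (HasGrad.coord_zero.mul HasGrad.coord_zero)).add
    (HasGrad.coord_one.mul HasGrad.coord_one)
  simp only [← pow_two] at h
  exact h.congr (by ring) (by ring)

theorem hasGrad_fsWeight (x : Fin 2 → ℝ) :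
    HasGrad fsWeight (-(2 * x 0 * fsWeight x ^ 2)) (-(2 * x 1 * fsWeight x ^ 2)) x := by
  refine ((hasGrad_one_add_sq x).inv (one_add_sq_pos x).ne').congr ?_ ?_ <;>
    simp only [fsWeight, inv_pow] <;> ring

theorem hasGrad_log_one_add_sq (x : Fin 2 → ℝ) :
    HasGrad (fun x => Real.log (1 + x 0 ^ 2 + x 1 ^ 2))
      (2 * x 0 * fsWeight x) (2 * x 1 * fsWeight x) x :=
  (HasGrad.comp (Real.hasDerivAt_log (one_add_sq_pos x).ne') (hasGrad_one_add_sq x)).congr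
    (mul_comm _ _) (mul_comm _ _)

theorem cpPotential_eq (R : ℝ) : cpPotential R = fun x =>
    gr (R ^ 2 * Real.log (1 + x 0 ^ 2 + x 1 ^ 2)) 0 0 (R ^ 2 * (2 * fsWeight x)) := by
  ext1 x
  have : cpN x = gr (1 + x 0 ^ 2 + x 1 ^ 2) 0 0 2 := by
    simp [cpN, const_eq_gr, odd_zero_eq_gr, odd_one_eq_gr, gr_mul, gr_smul, gr_add]
  rw [cpPotential, this, applyFun_gr, gr_smul, Real.deriv_log]
  simp [fsWeight, mul_comm]

theorem dc_inl_zero (R : ℝ) : dc (cpPotential R) (.inl 0) = fun x =>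
    gr (R ^ 2 * -(2 * x 1 * fsWeight x)) 0 0 (R ^ 2 * (4 * (x 1 * (fsWeight x * fsWeight x)))) := by
  ext1 x
  rw [dc, cpPotential_eq, pderiv_inl_one_gr ((HasGrad.const _).mul (hasGrad_log_one_add_sq x))
    (HasGrad.const 0) (HasGrad.const 0)
    ((HasGrad.const _).mul ((HasGrad.const _).mul (hasGrad_fsWeight x))), gr_neg]
  congr 1 <;> ring

theorem dc_inl_one (R : ℝ) : dc (cpPotential R) (.inl 1) = fun x =>
    gr (R ^ 2 * (2 * x 0 * fsWeight x)) 0 0 (R ^ 2 * -(4 * (x 0 * (fsWeight x * fsWeight x)))) := by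
  ext1 x
  rw [dc, cpPotential_eq, pderiv_inl_zero_gr ((HasGrad.const _).mul (hasGrad_log_one_add_sq x))
    (HasGrad.const 0) (HasGrad.const 0)
    ((HasGrad.const _).mul ((HasGrad.const _).mul (hasGrad_fsWeight x)))]
  congr 1 <;> ring

theorem dc_inr_zero (R : ℝ) : dc (cpPotential R) (.inr 0) = fun x =>
    gr 0 (R ^ 2 * (2 * fsWeight x)) 0 0 := by
  ext1 x
  simp [dc, cpPotential_eq, pderiv, oddDeriv_one_gr, gr_neg]

theorem dc_inr_one (R : ℝ) : dc (cpPotential R) (.inr 1) = fun x =>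
    gr 0 0 (R ^ 2 * (2 * fsWeight x)) 0 := by
  ext1 x
  simp [dc, cpPotential_eq, pderiv, oddDeriv_zero_gr]

/-- The components of the Fubini–Study form. -/
theorem fubiniStudy_eq (R : ℝ) (i : Fin 2) (x : Fin 2 → ℝ) :
    fubiniStudy R i x = fromBlocks
      !![0, gr (R ^ 2 * fsWeight x ^ 2) 0 0 (R ^ 2 * (2 * fsWeight x ^ 2 - 4 * fsWeight x ^ 3));
        gr (-(R ^ 2 * fsWeight x ^ 2)) 0 0 (-(R ^ 2 * (2 * fsWeight x ^ 2 - 4 * fsWeight x ^ 3))), 0]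
      !![gr 0 (-(R ^ 2 * x 0 * fsWeight x ^ 2)) (-(R ^ 2 * x 1 * fsWeight x ^ 2)) 0,
          gr 0 (R ^ 2 * x 1 * fsWeight x ^ 2) (-(R ^ 2 * x 0 * fsWeight x ^ 2)) 0;
        gr 0 (-(R ^ 2 * x 1 * fsWeight x ^ 2)) (R ^ 2 * x 0 * fsWeight x ^ 2) 0,
          gr 0 (-(R ^ 2 * x 0 * fsWeight x ^ 2)) (-(R ^ 2 * x 1 * fsWeight x ^ 2)) 0]
      !![gr 0 (R ^ 2 * x 0 * fsWeight x ^ 2) (R ^ 2 * x 1 * fsWeight x ^ 2) 0,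
          gr 0 (R ^ 2 * x 1 * fsWeight x ^ 2) (-(R ^ 2 * x 0 * fsWeight x ^ 2)) 0;
        gr 0 (-(R ^ 2 * x 1 * fsWeight x ^ 2)) (R ^ 2 * x 0 * fsWeight x ^ 2) 0,
          gr 0 (R ^ 2 * x 0 * fsWeight x ^ 2) (R ^ 2 * x 1 * fsWeight x ^ 2) 0]
      !![gr (R ^ 2 * fsWeight x) 0 0 0, 0; 0, gr (R ^ 2 * fsWeight x) 0 0 0] := by
  have hq := hasGrad_fsWeight x
  have h0 := HasGrad.coord_zero (x := x)
  have h1 := HasGrad.coord_one (x := x)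
  have hqq := hq.mul hq
  have c (r : ℝ) := HasGrad.const (x := x) r
  have a01 := (c (R ^ 2)).mul (((c 2).mul h1).mul hq).neg
  have a04 := (c (R ^ 2)).mul ((c 4).mul (h1.mul hqq))
  have a11 := (c (R ^ 2)).mul (((c 2).mul h0).mul hq)
  have a14 := (c (R ^ 2)).mul ((c 4).mul (h0.mul hqq)).neg
  have a2 := (c (R ^ 2)).mul ((c 2).mul hq)
  have z := c 0
  have hw := fsWeight_mul x
  ext A B
  rw [fubiniStudy, Matrix.smul_apply, extDeriv, Matrix.of_apply]
  rcases A with A | A <;> rcases B with B | B <;> fin_cases A <;> fin_cases B <;>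
  simp only [par, Fin.zero_eta, Fin.mk_one, Sum.elim_inl, Sum.elim_inr, dc_inl_zero, dc_inl_one,
    dc_inr_zero, dc_inr_one, fromBlocks_apply₁₁, fromBlocks_apply₁₂, fromBlocks_apply₂₁,
    fromBlocks_apply₂₂, Matrix.of_apply, Matrix.cons_val_zero, Matrix.cons_val_one,
    Matrix.cons_val_fin_one, Matrix.cons_val', pderiv_inl_zero_gr a01 z z a04,
    pderiv_inl_zero_gr a11 z z a14, pderiv_inl_one_gr a01 z z a04, pderiv_inl_one_gr a11 z z a14,
    pderiv_inl_zero_gr z a2 z z, pderiv_inl_zero_gr z z a2 z, pderiv_inl_one_gr z a2 z z,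
    pderiv_inl_one_gr z z a2 z, pderiv.eq_2, oddDeriv_zero_gr, oddDeriv_one_gr, gr_smul, gr_sub,
    zero_eq_gr]
  all_goals congr 1
  -- Besides polynomial identities, entries remain in which `x² + y²` must be eliminated through
  -- `q(1 + x² + y²) = 1`; the multipliers are the factors by which they miss being identities.
  all_goals first
    | ring1
    | linear_combination (-R ^ 2 * fsWeight x) * hw
    | linear_combination (R ^ 2 * fsWeight x) * hw
    | linear_combination (R ^ 2 * 4 * fsWeight x ^ 2) * hw
    | linear_combination (-R ^ 2 * 4 * fsWeight x ^ 2) * hw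

/-! ### The exterior derivative squares to zero -/

section ExteriorDerivative

variable {n m : ℕ} {f g : (Fin n → ℝ) → Grassmann m}

theorem eq_of_coeff {a b : Grassmann m} (h : ∀ I, coeff I a = coeff I b) : a = b :=
  monomial.ext_elem h

/-- A constant linear map acts on coefficients by a constant matrix, so it preserves smoothness and
commutes with even derivatives. -/
theorem coeff_map (T : Grassmann m →ₗ[ℝ] Grassmann m) (I : Finset (Fin m)) (a : Grassmann m) :
    coeff I (T a) = ∑ J, coeff J a * coeff I (T (monomial J)) := by
  conv_lhs => rw [← monomial.sum_repr a]
  simp only [map_sum, map_smul, smul_eq_mul]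
  rfl

theorem coeff_pderiv_inl (I : Finset (Fin m)) (a : Fin n) (f : (Fin n → ℝ) → Grassmann m)
    (x : Fin n → ℝ) : coeff I (pderiv (.inl a) f x) =
      fderiv ℝ (fun y => coeff I (f y)) x (Pi.single a 1) := by
  simp [pderiv, coeff, Finsupp.single_apply]

theorem SmoothOn.differentiableAt (hf : SmoothOn f Set.univ) (I : Finset (Fin m)) (x : Fin n → ℝ) :
    DifferentiableAt ℝ (fun y => coeff I (f y)) x :=
  (contDiffOn_univ.1 (hf I)).contDiffAt.differentiableAt (by simp)

theorem SmoothOn.pderiv (hf : SmoothOn f Set.univ) (A : Fin n ⊕ Fin m) :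
    SmoothOn (pderiv A f) Set.univ := by
  intro I
  rw [contDiffOn_univ]
  rcases A with a | μ
  · simp only [coeff_pderiv_inl]
    exact ((contDiffOn_univ.1 (hf I)).fderiv_right (m := ∞) (by simp)).clm_apply contDiff_const
  · simp only [Supergeometry.pderiv, coeff_map (oddDeriv μ) I (f _)]
    exact ContDiff.sum fun J _ => (contDiffOn_univ.1 (hf J)).mul contDiff_const

theorem pderiv_sub (hf : SmoothOn f Set.univ) (hg : SmoothOn g Set.univ) (A : Fin n ⊕ Fin m)
    (x : Fin n → ℝ) : pderiv A (fun y => f y - g y) x = pderiv A f x - pderiv A g x := by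
  rcases A with a | μ
  · refine eq_of_coeff fun I => ?_
    simp only [coeff_pderiv_inl, map_sub]
    rw [fderiv_fun_sub (hf.differentiableAt I x) (hg.differentiableAt I x)]
    rfl
  · simp [pderiv]

theorem pderiv_smul (hf : SmoothOn f Set.univ) (c : ℝ) (A : Fin n ⊕ Fin m) (x : Fin n → ℝ) :
    pderiv A (fun y => c • f y) x = c • pderiv A f x := by
  rcases A with a | μ
  · refine eq_of_coeff fun I => ?_
    simp only [coeff_pderiv_inl, map_smul, smul_eq_mul]
    rw [fderiv_const_mul (hf.differentiableAt I x)]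
    rfl
  · simp [pderiv]

theorem SmoothOn.const_smul (hf : SmoothOn f Set.univ) (c : ℝ) :
    SmoothOn (fun y => c • f y) Set.univ := fun I => by
  simpa using contDiffOn_const.mul (hf I)

theorem SmoothOn.sub (hf : SmoothOn f Set.univ) (hg : SmoothOn g Set.univ) :
    SmoothOn (fun y => f y - g y) Set.univ := fun I => by
  simpa using (hf I).sub (hg I)

theorem pderiv_inl_oddDeriv (hf : SmoothOn f Set.univ) (a : Fin n) (μ : Fin m) (x : Fin n → ℝ) :
    pderiv (.inl a) (fun y => oddDeriv μ (f y)) x = oddDeriv μ (pderiv (.inl a) f x) := by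
  refine eq_of_coeff fun I => ?_
  rw [coeff_pderiv_inl, coeff_map]
  simp only [coeff_map (oddDeriv μ) I (f _), coeff_pderiv_inl]
  rw [fderiv_fun_sum fun J _ => (hf.differentiableAt J x).mul_const _]
  simp only [FunLike.coe_sum, Finset.sum_apply]
  refine Finset.sum_congr rfl fun J _ => ?_
  rw [fderiv_mul_const (hf.differentiableAt J x)]
  simp [mul_comm]

/-- Three facts combine: symmetry of second derivatives, constancy of the coefficients of odd
derivatives, and anticommutativity of contractions. -/
theorem pderiv_pderiv_comm (hf : SmoothOn f Set.univ) (A B : Fin n ⊕ Fin m) (x : Fin n → ℝ) :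
    pderiv A (pderiv B f) x = (-1 : ℝ) ^ (par A * par B) • pderiv B (pderiv A f) x := by
  rcases A with a | μ <;> rcases B with b | ν
  · refine eq_of_coeff fun I => ?_
    have h : ContDiff ℝ ∞ fun y => coeff I (f y) := contDiffOn_univ.1 (hf I)
    have hd : DifferentiableAt ℝ (fderiv ℝ fun y => coeff I (f y)) x :=
      (h.fderiv_right (m := ∞) (by simp)).contDiffAt.differentiableAt (by simp)
    simp only [par, Sum.elim_inl, mul_zero, pow_zero, one_smul, coeff_pderiv_inl]
    rw [fderiv_clm_apply hd (by fun_prop), fderiv_clm_apply hd (by fun_prop)]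
    simpa using (h.contDiffAt.isSymmSndFDerivAt (by simpa using WithTop.coe_le_coe.2 (le_top (a := (2 : ℕ∞))))).eq _ _
  · simp only [par, Sum.elim_inl, zero_mul, pow_zero, one_smul]
    exact pderiv_inl_oddDeriv hf a ν x
  · simp only [par, Sum.elim_inl, mul_zero, pow_zero, one_smul]
    exact (pderiv_inl_oddDeriv hf b μ x).symm
  · simp only [par, Sum.elim_inr, mul_one, pow_one, neg_smul, one_smul]
    exact CliffordAlgebra.contractLeft_comm (Q := (0 : QuadraticForm ℝ (Fin m → ℝ))) _ _ (f x)

/-- The six second derivatives form three pairs, one for each component of `α`, and graded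
commutation cancels each pair. -/
theorem extDeriv_closed {α : Fin n ⊕ Fin m → (Fin n → ℝ) → Grassmann m}
    (hα : ∀ A, SmoothOn (α A) Set.univ) (A B C : Fin n ⊕ Fin m) (x : Fin n → ℝ) :
    pderiv A (fun y => extDeriv α y B C) x
      - (-1 : ℝ) ^ (par A * par B) • pderiv B (fun y => extDeriv α y A C) x
      + (-1 : ℝ) ^ (par C * (par A + par B)) • pderiv C (fun y => extDeriv α y A B) x = 0 := by
  have key (A B C : Fin n ⊕ Fin m) : pderiv A (fun y => extDeriv α y B C) x =
      pderiv A (pderiv B (α C)) x -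
        (-1 : ℝ) ^ (par B * par C) • pderiv A (pderiv C (α B)) x := by
    simp only [extDeriv, Matrix.of_apply]
    rw [pderiv_sub ((hα C).pderiv B) (((hα B).pderiv C).const_smul _),
      pderiv_smul ((hα B).pderiv C)]
  rw [key, key, key, pderiv_pderiv_comm (hα C) A B, pderiv_pderiv_comm (hα B) A C,
    pderiv_pderiv_comm (hα A) B C]
  -- Only the consistency of the signs is left, one check for each of the eight parity patterns.
  rcases A with A | A <;> rcases B with B | B <;> rcases C with C | C <;> simp [par] <;> abel

theorem extDeriv_antisymm (α : Fin n ⊕ Fin m → (Fin n → ℝ) → Grassmann m) (A B : Fin n ⊕ Fin m)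
    (x : Fin n → ℝ) :
    extDeriv α x A B = -((-1 : ℝ) ^ (par A * par B) • extDeriv α x B A) := by
  simp only [extDeriv, Matrix.of_apply, mul_comm (par B)]
  rcases A with A | A <;> rcases B with B | B <;> simp [par]

end ExteriorDerivative

/-! ### The Fubini–Study form in one chart -/

theorem smoothOn_dc (R : ℝ) (A : Fin 2 ⊕ Fin 2) : SmoothOn (dc (cpPotential R) A) Set.univ := by
  have hq := contDiff_fsWeight
  rcases A with A | A <;> fin_cases A <;>
    simp only [Fin.zero_eta, Fin.mk_one, dc_inl_zero, dc_inl_one, dc_inr_zero, dc_inr_one] <;>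
    apply smoothOn_gr <;> rw [contDiffOn_univ] <;> fun_prop

theorem smoothOn_fubiniStudy (R : ℝ) (i : Fin 2) (A B : Fin 2 ⊕ Fin 2) :
    SmoothOn (fun x => fubiniStudy R i x A B) Set.univ :=
  (((smoothOn_dc R B).pderiv A).sub (((smoothOn_dc R A).pderiv B).const_smul _)).const_smul _

theorem hasParity_fubiniStudy (R : ℝ) (i : Fin 2) (x : Fin 2 → ℝ) (A B : Fin 2 ⊕ Fin 2) :
    HasParity (par A + par B) (fubiniStudy R i x A B) := by
  rw [fubiniStudy_eq]
  rcases A with A | A <;> rcases B with B | B <;> fin_cases A <;> fin_cases B <;>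
    simp [par, zero_eq_gr, hasParity_zero_gr, hasParity_one_gr, (hasParity_zero_gr _ _).add_two]

theorem fubiniStudy_antisymm (R : ℝ) (i : Fin 2) (x : Fin 2 → ℝ) (A B : Fin 2 ⊕ Fin 2) :
    fubiniStudy R i x A B = -((-1 : ℝ) ^ (par A * par B) • fubiniStudy R i x B A) := by
  simp only [fubiniStudy, Matrix.smul_apply]
  rw [extDeriv_antisymm, smul_neg, smul_comm]

theorem fubiniStudy_closed (R : ℝ) (i : Fin 2) (x : Fin 2 → ℝ) (A B C : Fin 2 ⊕ Fin 2) :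
    pderiv A (fun y => fubiniStudy R i y B C) x
      - (-1 : ℝ) ^ (par A * par B) • pderiv B (fun y => fubiniStudy R i y A C) x
      + (-1 : ℝ) ^ (par C * (par A + par B)) • pderiv C (fun y => fubiniStudy R i y A B) x = 0 := by
  have key (A B C : Fin 2 ⊕ Fin 2) : pderiv A (fun y => fubiniStudy R i y B C) x =
      (1 / 4 : ℝ) • pderiv A (fun y => extDeriv (dc (cpPotential R)) y B C) x :=
    pderiv_smul (((smoothOn_dc R C).pderiv B).sub (((smoothOn_dc R B).pderiv C).const_smul _)) _ _ _
  rw [key, key, key, smul_comm _ (1 / 4 : ℝ), smul_comm _ (1 / 4 : ℝ), ← smul_sub, ← smul_add,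
    extDeriv_closed (smoothOn_dc R), smul_zero]

theorem body_fubiniStudy (R : ℝ) (i : Fin 2) (x : Fin 2 → ℝ) :
    (fubiniStudy R i x).map body = fromBlocks
      !![0, R ^ 2 * fsWeight x ^ 2; -(R ^ 2 * fsWeight x ^ 2), 0] 0 0
      !![R ^ 2 * fsWeight x, 0; 0, R ^ 2 * fsWeight x] := by
  rw [fubiniStudy_eq]
  ext A B
  rcases A with A | A <;> rcases B with B | B <;> fin_cases A <;> fin_cases B <;> simp

theorem fubiniStudy_nondegenerate {R : ℝ} (hR : 0 < R) (i : Fin 2) (x : Fin 2 → ℝ) :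
    ((fubiniStudy R i x).map body).det ≠ 0 := by
  have hq := (fsWeight_pos x).ne'
  rw [body_fubiniStudy, det_fromBlocks_zero₂₁, det_fin_two_of, det_fin_two_of]
  simp [hq, hR.ne']

/-! ### The Berezinian of the Fubini–Study form -/

theorem inverse_gr {a : ℝ} (ha : a ≠ 0) : Ring.inverse (gr a 0 0 0) = gr a⁻¹ 0 0 0 := by
  apply inverse_eq_of_mul_eq_one <;> simp [gr_mul, one_eq_gr, ha]

theorem inverse_diag_gr {a : ℝ} (ha : a ≠ 0) :
    Ring.inverse (!![gr a 0 0 0, 0; 0, gr a 0 0 0] : Matrix (Fin 2) (Fin 2) (Grassmann 2)) =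
      !![gr a⁻¹ 0 0 0, 0; 0, gr a⁻¹ 0 0 0] := by
  apply inverse_eq_of_mul_eq_one <;> ext i j <;> fin_cases i <;> fin_cases j <;>
    simp [Matrix.mul_apply, gr_mul, one_eq_gr, ha]

theorem evenDet_diag_gr (a : ℝ) :
    evenDet (!![gr a 0 0 0, 0; 0, gr a 0 0 0] : Matrix (Fin 2) (Fin 2) (Grassmann 2)) =
      gr (a ^ 2) 0 0 0 := by
  simp [evenDet_fin_two, gr_mul, pow_two]

/-- The Schur complement is antisymmetric with upper right entry `R²(q² - 2q³ξη)`, so its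
determinant is `R⁴(q⁴ - 4q⁵ξη)`; the odd block has determinant `R⁴q²`. -/
theorem ber_fubiniStudy {R : ℝ} (hR : 0 < R) (i : Fin 2) (x : Fin 2 → ℝ) :
    ber (fubiniStudy R i x) = gr (fsWeight x ^ 2) 0 0 (-(4 * fsWeight x ^ 3)) := by
  have hq := (fsWeight_pos x).ne'
  have hw := fsWeight_mul x
  have ha : R ^ 2 * fsWeight x ≠ 0 := by positivity
  rw [fubiniStudy_eq, ber, toBlocks_fromBlocks₁₁, toBlocks_fromBlocks₁₂, toBlocks_fromBlocks₂₁,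
    toBlocks_fromBlocks₂₂, inverse_diag_gr ha, evenDet_diag_gr, inverse_gr (pow_ne_zero 2 ha),
    evenDet_fin_two]
  simp only [Matrix.sub_apply, Matrix.mul_apply, Fin.sum_univ_two, Matrix.of_apply,
    Matrix.cons_val_zero, Matrix.cons_val_one, Matrix.cons_val_fin_one, Matrix.cons_val',
    zero_eq_gr, gr_mul, gr_add, gr_sub]
  congr 1
  · field_simp
    ring
  · simp
  · simp
  · simp only [mul_zero, zero_mul, add_zero, zero_add, sub_zero, zero_sub]
    field_simp
    linear_combination -4 * hw

/-! ### The coordinate change of `CP^{1|1}` -/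

/-- The map `w ↦ 1 / w` in real coordinates. -/
noncomputable def inversion (x : Fin 2 → ℝ) : Fin 2 → ℝ := ofComplex (toComplex x)⁻¹

theorem toComplex_inversion (x : Fin 2 → ℝ) : toComplex (inversion x) = (toComplex x)⁻¹ := rfl

@[simp] theorem inversion_inversion (x : Fin 2 → ℝ) : inversion (inversion x) = x := by
  rw [inversion, toComplex_inversion, inv_inv, ofComplex_toComplex]

theorem inversion_zero_apply (x : Fin 2 → ℝ) : inversion x 0 = x 0 * (x 0 ^ 2 + x 1 ^ 2)⁻¹ := by
  simp [inversion, ofComplex, toComplex, Complex.inv_re, Complex.normSq_apply, div_eq_mul_inv,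
    pow_two]

theorem inversion_one_apply (x : Fin 2 → ℝ) : inversion x 1 = -x 1 * (x 0 ^ 2 + x 1 ^ 2)⁻¹ := by
  simp [inversion, ofComplex, toComplex, Complex.inv_im, Complex.normSq_apply, div_eq_mul_inv,
    pow_two]

theorem sq_add_sq_ne_zero {x : Fin 2 → ℝ} (hx : x ≠ 0) : x 0 ^ 2 + x 1 ^ 2 ≠ 0 := by
  intro h
  apply hx
  ext i
  fin_cases i
  · simpa using (by nlinarith [sq_nonneg (x 0), sq_nonneg (x 1)] : x 0 ^ 2 = 0)
  · simpa using (by nlinarith [sq_nonneg (x 0), sq_nonneg (x 1)] : x 1 ^ 2 = 0)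

theorem inversion_ne_zero {x : Fin 2 → ℝ} (hx : x ≠ 0) : inversion x ≠ 0 := by
  rw [← toComplex_ne_zero, toComplex_inversion]
  exact inv_ne_zero (toComplex_ne_zero.2 hx)

/-- This is `1 + |w|² = |w|²(1 + |w'|²)`, inverted. -/
theorem fsWeight_eq_mul_fsWeight_inversion {x : Fin 2 → ℝ} (hx : x ≠ 0) :
    fsWeight x = (inversion x 0 ^ 2 + inversion x 1 ^ 2) * fsWeight (inversion x) := by
  have hs := sq_add_sq_ne_zero hx
  have := one_add_sq_pos x
  simp only [fsWeight, inversion_zero_apply, inversion_one_apply]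
  field_simp
  ring

/-- The entries are the real and imaginary parts of `dw' = -w'² dw`. -/
theorem hasGrad_inversion {x : Fin 2 → ℝ} (hx : x ≠ 0) :
    HasGrad (fun y => inversion y 0) (inversion x 1 ^ 2 - inversion x 0 ^ 2)
      (2 * inversion x 0 * inversion x 1) x ∧
    HasGrad (fun y => inversion y 1) (-(2 * inversion x 0 * inversion x 1))
      (inversion x 1 ^ 2 - inversion x 0 ^ 2) x := by
  have hs := sq_add_sq_ne_zero hx
  have h := (HasGrad.coord_zero (x := x).mul HasGrad.coord_zero).add
    (HasGrad.coord_one.mul HasGrad.coord_one)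
  simp only [← pow_two] at h
  have hi := h.inv hs
  simp only [inversion_zero_apply, inversion_one_apply]
  constructor
  · refine (HasGrad.coord_zero.mul hi).congr ?_ ?_ <;> field_simp <;> ring
  · refine (HasGrad.coord_one.neg.mul hi).congr ?_ ?_ <;> field_simp <;> ring

theorem contDiffOn_inversion (i : Fin 2) :
    ContDiffOn ℝ ∞ (fun x => inversion x i) {x | x ≠ 0} := by
  have h : ContDiffOn ℝ ∞ (fun x : Fin 2 → ℝ => (x 0 ^ 2 + x 1 ^ 2)⁻¹) {x | x ≠ 0} :=
    ContDiffOn.inv (by fun_prop) fun x hx => sq_add_sq_ne_zero hx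
  fin_cases i
  · simp only [Fin.zero_eta, inversion_zero_apply]
    exact ContDiffOn.mul (by fun_prop) h
  · simp only [Fin.mk_one, inversion_one_apply]
    exact ContDiffOn.mul (by fun_prop) h

theorem overlap_ne {i j : Fin 2} (h : i ≠ j) : CP11.overlap i j = {x | x ≠ 0} := by
  ext x
  simp only [SuperAtlas.overlap, CP11, Set.univ_inter, Set.image_univ, Set.mem_preimage,
    Set.mem_range, Set.mem_ofPred_eq, ← toComplex_ne_zero]
  constructor
  · rintro ⟨y, hy⟩
    exact left_ne_zero_of_mul_eq_one ((cpParam_eq_iff_ne h).1 hy.symm)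
  · intro hx
    exact ⟨inversion x, ((cpParam_eq_iff_ne h).2 (mul_inv_cancel₀ hx)).symm⟩

theorem trans_self (i : Fin 2) : CP11.trans i i = coordFun := by
  funext A x
  simp [CP11]

section Transition

variable {i j : Fin 2} (h : i ≠ j)
include h

theorem trans_inl (a : Fin 2) (x : Fin 2 → ℝ) :
    CP11.trans i j (.inl a) x = const (inversion x a) := by
  fin_cases a <;> simp [CP11, h, inversion, ofComplex]

theorem trans_inr_zero : CP11.trans i j (.inr 0) =
    fun x => gr 0 (inversion x 0) (-inversion x 1) 0 := by
  funext x
  simp [CP11, h, inversion, ofComplex, odd_zero_eq_gr, odd_one_eq_gr, gr_smul, gr_sub]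

theorem trans_inr_one : CP11.trans i j (.inr 1) =
    fun x => gr 0 (inversion x 1) (inversion x 0) 0 := by
  funext x
  simp [CP11, h, inversion, ofComplex, odd_zero_eq_gr, odd_one_eq_gr, gr_smul, gr_add]

theorem bodyMap_trans (x : Fin 2 → ℝ) : bodyMap (CP11.trans i j) x = inversion x := by
  funext a
  simp [bodyMap, trans_inl h]

/-- The odd coordinates undergo multiplication by `w'`, so `ξ'η' = |w'|² ξη`. -/
theorem pullback_trans (f : (Fin 2 → ℝ) → Grassmann 2) {x : Fin 2 → ℝ} {a b c d : ℝ}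
    (hf : f (inversion x) = gr a b c d) :
    pullback (CP11.trans i j) f x =
      gr a (b * inversion x 0 + c * inversion x 1) (c * inversion x 0 - b * inversion x 1)
        (d * (inversion x 0 ^ 2 + inversion x 1 ^ 2)) := by
  rw [pullback_gr (trans_inl h · x) f hf, trans_inr_zero h, trans_inr_one h]
  simp only [const_eq_gr, gr_mul, gr_smul, gr_add]
  congr 1 <;> ring

/-- The lower left block vanishes because the new even coordinates do not involve the odd ones. The
upper right block records how `θ' = w'θ` varies with `w`. -/
theorem jacobian_trans {x : Fin 2 → ℝ} (hx : x ≠ 0) {u v p t : ℝ} (hu : inversion x 0 = u)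
    (hv : inversion x 1 = v) (hp : v ^ 2 - u ^ 2 = p) (ht : 2 * u * v = t) :
    jacobian (CP11.trans i j) x = fromBlocks
      !![gr p 0 0 0, gr (-t) 0 0 0; gr t 0 0 0, gr p 0 0 0]
      !![gr 0 p t 0, gr 0 (-t) p 0; gr 0 t (-p) 0, gr 0 p t 0]
      0
      !![gr u 0 0 0, gr v 0 0 0; gr (-v) 0 0 0, gr u 0 0 0] := by
  obtain ⟨h0, h1⟩ := hasGrad_inversion hx
  rw [hu, hv, hp, ht] at h0 h1
  have z := HasGrad.const (x := x) 0
  have t0 : CP11.trans i j (.inl 0) = fun x => gr (inversion x 0) 0 0 0 := by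
    funext y; rw [trans_inl h, const_eq_gr]
  have t1 : CP11.trans i j (.inl 1) = fun x => gr (inversion x 1) 0 0 0 := by
    funext y; rw [trans_inl h, const_eq_gr]
  ext A B
  rw [jacobian, Matrix.of_apply]
  rcases A with A | A <;> rcases B with B | B <;> fin_cases A <;> fin_cases B <;>
  simp only [Fin.zero_eta, Fin.mk_one, t0, t1, trans_inr_zero h, trans_inr_one h,
    fromBlocks_apply₁₁, fromBlocks_apply₁₂, fromBlocks_apply₂₁, fromBlocks_apply₂₂,
    Matrix.of_apply, Matrix.cons_val_zero, Matrix.cons_val_one, Matrix.cons_val_fin_one,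
    Matrix.cons_val', Matrix.zero_apply, pderiv_inl_zero_gr h0 z z z, pderiv_inl_zero_gr h1 z z z,
    pderiv_inl_one_gr h0 z z z, pderiv_inl_one_gr h1 z z z, pderiv_inl_zero_gr z h0 h1.neg z,
    pderiv_inl_one_gr z h0 h1.neg z, pderiv_inl_zero_gr z h1 h0 z, pderiv_inl_one_gr z h1 h0 z,
    pderiv.eq_2, oddDeriv_zero_gr, oddDeriv_one_gr, hu, hv, zero_eq_gr, neg_neg, neg_zero]

end Transition

/-! ### The supermanifold laws and the orientation -/

theorem jacobian_coordFun (x : Fin 2 → ℝ) : jacobian (coordFun (n := 2) (m := 2)) x = 1 := by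
  have h0 := HasGrad.coord_zero (x := x)
  have h1 := HasGrad.coord_one (x := x)
  have z := HasGrad.const (x := x) 0
  ext A B
  rw [jacobian, Matrix.of_apply]
  rcases A with A | A <;> rcases B with B | B <;> fin_cases A <;> fin_cases B <;>
  simp [coordFun, const_eq_gr, odd_zero_eq_gr, odd_one_eq_gr, pderiv_inl_zero_gr h0 z z z,
    pderiv_inl_one_gr h0 z z z, pderiv_inl_zero_gr h1 z z z, pderiv_inl_one_gr h1 z z z,
    pderiv_even_gr, pderiv.eq_2, oddDeriv_zero_gr, oddDeriv_one_gr, one_eq_gr, zero_eq_gr]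

theorem smoothOn_coordFun (A : Fin 2 ⊕ Fin 2) (U : Set (Fin 2 → ℝ)) : SmoothOn (coordFun A) U := by
  rcases A with A | A
  · simp only [coordFun, Sum.elim_inl, const_eq_gr]
    apply smoothOn_gr <;> fun_prop
  · exact fun I => contDiffOn_const (c := coeff I (odd A))

theorem hasParity_coordFun (A : Fin 2 ⊕ Fin 2) (x : Fin 2 → ℝ) :
    HasParity (par A) (coordFun A x : Grassmann 2) := by
  rcases A with A | A <;> fin_cases A <;>
    simp [par, coordFun, const_eq_gr, odd_zero_eq_gr, odd_one_eq_gr, hasParity_zero_gr,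
      hasParity_one_gr]

theorem isSupermanifold_CP11 : CP11.IsSupermanifold where
  t2 := inferInstance
  secondCountable := inferInstance
  isOpen_dom _ := isOpen_univ
  isOpenEmbedding i := (isOpenEmbedding_cpParam i).comp isOpen_univ.isOpenEmbedding_subtypeVal
  cover p := by
    induction p using Projectivization.ind with | h v hv =>
    obtain ⟨i, hi⟩ := Function.ne_iff.1 hv
    exact ⟨i, _, Set.mem_univ _, (mk_eq_cpParam hv hi).symm⟩
  smooth i j A := by
    by_cases h : i = j
    · subst h
      rw [trans_self]
      exact smoothOn_coordFun A _
    · rw [overlap_ne h]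
      have h0 := contDiffOn_inversion 0
      have h1 := contDiffOn_inversion 1
      rcases A with A | A
      · simp only [SmoothOn, trans_inl h, const_eq_gr]
        exact smoothOn_gr (contDiffOn_inversion A) contDiffOn_const contDiffOn_const
          contDiffOn_const
      · fin_cases A
        · simp only [Fin.zero_eta, trans_inr_zero h]
          exact smoothOn_gr contDiffOn_const h0 h1.neg contDiffOn_const
        · simp only [Fin.mk_one, trans_inr_one h]
          exact smoothOn_gr contDiffOn_const h1 h0 contDiffOn_const
  parity i j A x _ := by
    by_cases h : i = j
    · subst h
      rw [trans_self]
      exact hasParity_coordFun A x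
    · rcases A with A | A
      · rw [trans_inl h, const_eq_gr]
        exact hasParity_zero_gr _ _
      · fin_cases A
        · simp only [Fin.zero_eta, trans_inr_zero h]
          exact hasParity_one_gr _ _
        · simp only [Fin.mk_one, trans_inr_one h]
          exact hasParity_one_gr _ _
  body_mem _ _ _ _ := Set.mem_univ _
  body_eq i j x hx := by
    by_cases h : i = j
    · subst h
      congr 1
      funext a
      simp [trans_self, bodyMap, coordFun]
    · rw [overlap_ne h] at hx
      rw [bodyMap_trans h]
      exact ((cpParam_eq_iff_ne h).2 (mul_inv_cancel₀ (toComplex_ne_zero.2 hx))).symm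
  refl i A x _ := by rw [trans_self]
  cocycle i j k A x hx := by
    by_cases h : i = j
    · subst h
      rw [pullback_of_coordFun fun A => by rw [trans_self]]
    · have hx0 : x ≠ 0 := by
        have := hx.1
        rwa [overlap_ne h] at this
      by_cases h' : j = k
      · subst h'
        rw [trans_self]
        rcases A with A | A
        · rw [pullback_trans h (coordFun (.inl A)) (x := x) (a := inversion x A) (b := 0) (c := 0) (d := 0)
            (by simp [coordFun, const_eq_gr]), trans_inl h, const_eq_gr]
          simp
        · fin_cases A
          · simp only [Fin.zero_eta]
            rw [pullback_trans h (coordFun (.inr 0)) (x := x) (a := 0) (b := 1) (c := 0) (d := 0)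
              (by simp [coordFun, odd_zero_eq_gr]), trans_inr_zero h]
            simp
          · simp only [Fin.mk_one]
            rw [pullback_trans h (coordFun (.inr 1)) (x := x) (a := 0) (b := 0) (c := 1) (d := 0)
              (by simp [coordFun, odd_one_eq_gr]), trans_inr_one h]
            simp
      -- There are only two charts, so the remaining case is a change of chart and back, where
      -- inversion must cancel itself.
      · obtain rfl : i = k := by omega
        have hs := sq_add_sq_ne_zero hx0
        rw [trans_self]
        rcases A with A | A
        · rw [pullback_trans h (CP11.trans j i (.inl A)) (x := x) (a := x A) (b := 0) (c := 0) (d := 0)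
            (by simp [trans_inl h', const_eq_gr])]
          simp [coordFun, const_eq_gr]
        · fin_cases A
          · simp only [Fin.zero_eta]
            rw [pullback_trans h (CP11.trans j i (.inr 0)) (x := x) (a := 0) (b := x 0) (c := -x 1) (d := 0)
              (by simp [trans_inr_zero h']), coordFun, Sum.elim_inr, odd_zero_eq_gr,
              inversion_zero_apply, inversion_one_apply]
            congr 1 <;> field_simp <;> ring
          · simp only [Fin.mk_one]
            rw [pullback_trans h (CP11.trans j i (.inr 1)) (x := x) (a := 0) (b := x 1) (c := x 0) (d := 0)
              (by simp [trans_inr_one h']), coordFun, Sum.elim_inr, odd_one_eq_gr,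
              inversion_zero_apply, inversion_one_apply]
            congr 1 <;> field_simp <;> ring

/-- The diagonal blocks are multiplications by the complex numbers `-w'²` and `w'` in real
coordinates, so their determinants are the squared moduli `|w'|⁴` and `|w'|²`. -/
theorem isOriented_CP11 : CP11.IsOriented := by
  intro i j x hx
  by_cases h : i = j
  · subst h
    rw [trans_self, jacobian_coordFun, Matrix.map_one _ (map_zero _) (map_one _),
      ← fromBlocks_one, toBlocks_fromBlocks₁₁, toBlocks_fromBlocks₂₂]
    simp
  · rw [overlap_ne h] at hx
    have hn := sq_add_sq_ne_zero (inversion_ne_zero hx)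
    have hn' : 0 < inversion x 0 ^ 2 + inversion x 1 ^ 2 := lt_of_le_of_ne (by positivity) hn.symm
    rw [jacobian_trans h hx rfl rfl rfl rfl, fromBlocks_map, toBlocks_fromBlocks₁₁,
      toBlocks_fromBlocks₂₂]
    simp only [det_fin_two, Matrix.map_apply, Matrix.of_apply, Matrix.cons_val_zero,
      Matrix.cons_val_one, Matrix.cons_val_fin_one, Matrix.cons_val', body_gr]
    constructor
    · refine (pow_pos hn' 2).trans_eq ?_
      ring
    · refine hn'.trans_eq ?_
      ring

/-! ### Invariance of the form under the coordinate change -/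

theorem pullback_fubiniStudy {i j : Fin 2} (h : i ≠ j) (R : ℝ) (x : Fin 2 → ℝ) {q s : ℝ}
    (hq : fsWeight (inversion x) = q) (hs : inversion x 0 ^ 2 + inversion x 1 ^ 2 = s)
    (A B : Fin 2 ⊕ Fin 2) :
    pullback (CP11.trans i j) (fun y => fubiniStudy R j y A B) x = fromBlocks
      !![0, gr (R ^ 2 * q ^ 2) 0 0 (R ^ 2 * (2 * q ^ 2 - 4 * q ^ 3) * s);
        gr (-(R ^ 2 * q ^ 2)) 0 0 (-(R ^ 2 * (2 * q ^ 2 - 4 * q ^ 3) * s)), 0]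
      !![gr 0 (-(R ^ 2 * q ^ 2 * s)) 0 0, gr 0 0 (-(R ^ 2 * q ^ 2 * s)) 0;
        gr 0 0 (R ^ 2 * q ^ 2 * s) 0, gr 0 (-(R ^ 2 * q ^ 2 * s)) 0 0]
      !![gr 0 (R ^ 2 * q ^ 2 * s) 0 0, gr 0 0 (-(R ^ 2 * q ^ 2 * s)) 0;
        gr 0 0 (R ^ 2 * q ^ 2 * s) 0, gr 0 (R ^ 2 * q ^ 2 * s) 0 0]
      !![gr (R ^ 2 * q) 0 0 0, 0; 0, gr (R ^ 2 * q) 0 0 0] A B := by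
  refine (pullback_trans h (fun y => fubiniStudy R j y A B) (eq_gr_coeff _)).trans ?_
  -- The odd entries are, up to sign and scale, the real and imaginary parts of `w̄'θ'`. As `θ' =
  -- w'θ`, this is `|w'|²θ`, so each pulls back to a multiple of a single generator.
  simp only [fubiniStudy_eq, hq, ← hs]
  rcases A with A | A <;> rcases B with B | B <;> fin_cases A <;> fin_cases B <;>
  simp only [Fin.zero_eta, Fin.mk_one,
    fromBlocks_apply₁₁, fromBlocks_apply₁₂, fromBlocks_apply₂₁, fromBlocks_apply₂₂,
    Matrix.of_apply, Matrix.cons_val_zero, Matrix.cons_val_one, Matrix.cons_val_fin_one,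
    Matrix.cons_val', coeff_empty_gr, coeff_zero_gr, coeff_one_gr, coeff_pair_gr, zero_eq_gr] <;>
  congr 1 <;> ring

-- Conceptually, `N = |w|² N'` and `ln |w|²` is annihilated by `∂∂̄`. The proof compares components
-- directly.
set_option maxHeartbeats 1000000 in
theorem fubiniStudy_compat (R : ℝ) (i j : Fin 2) (A' B' : Fin 2 ⊕ Fin 2) (x : Fin 2 → ℝ)
    (hx : x ∈ CP11.overlap i j) : fubiniStudy R i x A' B' =
      ∑ A, ∑ B, (-1 : ℝ) ^ (par B * (par B' + 1)) •
        (jacobian (CP11.trans i j) x A' A *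
          pullback (CP11.trans i j) (fun y => fubiniStudy R j y A B) x *
            jacobian (CP11.trans i j) x B' B) := by
  by_cases h : i = j
  · subst h
    rw [trans_self, jacobian_coordFun]
    simp only [pullback_of_coordFun fun _ => rfl, Matrix.one_apply]
    rw [Finset.sum_eq_single A' (by intro b _ hb; simp [hb.symm]) (by simp),
      Finset.sum_eq_single B' (by intro b _ hb; simp [hb.symm]) (by simp)]
    rcases B' with B' | B' <;> simp [par]
  · rw [overlap_ne h] at hx
    have hn := sq_add_sq_ne_zero (inversion_ne_zero hx)
    have hw := fsWeight_mul (inversion x)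
    -- Expressing `x` through its inverse point makes every entry rational in `u`, `v`, `q`, with
    -- `q(1 + u² + v²) = 1` as the only relation.
    have e0 := inversion_zero_apply (inversion x)
    have e1 := inversion_one_apply (inversion x)
    rw [inversion_inversion] at e0 e1
    have eq := fsWeight_eq_mul_fsWeight_inversion hx
    simp only [pullback_fubiniStudy h R x rfl rfl, jacobian_trans h hx rfl rfl rfl rfl]
    rw [fubiniStudy_eq, eq, e0, e1]
    generalize inversion x 0 = u at *
    generalize inversion x 1 = v at *
    generalize fsWeight (inversion x) = q at *
    simp only [Fintype.sum_sum_type, Fin.sum_univ_two]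
    rcases A' with A | A <;> rcases B' with B | B <;> fin_cases A <;> fin_cases B <;>
    simp only [Fin.zero_eta, Fin.mk_one, par, Sum.elim_inl, Sum.elim_inr,
      fromBlocks_apply₁₁, fromBlocks_apply₁₂, fromBlocks_apply₂₁, fromBlocks_apply₂₂,
      Matrix.of_apply, Matrix.cons_val_zero, Matrix.cons_val_one, Matrix.cons_val_fin_one,
      Matrix.cons_val', Matrix.zero_apply, gr_mul, gr_smul, gr_add, zero_eq_gr, mul_zero, zero_mul,
      add_zero, zero_add, sub_zero, zero_sub, one_mul, mul_one, pow_zero, pow_one]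
    all_goals congr 1
    all_goals try ring1
    all_goals field_simp
    all_goals first
      | linear_combination (R ^ 2 * u * (u ^ 2 + v ^ 2) * q) * hw
      | linear_combination (-R ^ 2 * u * (u ^ 2 + v ^ 2) * q) * hw
      | linear_combination (R ^ 2 * v * (u ^ 2 + v ^ 2) * q) * hw
      | linear_combination (-R ^ 2 * v * (u ^ 2 + v ^ 2) * q) * hw
      | linear_combination (2 * R ^ 2 * (u ^ 2 + v ^ 2) ^ 2 * q) * hw
      | linear_combination (-2 * R ^ 2 * (u ^ 2 + v ^ 2) ^ 2 * q) * hw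

theorem isSymplectic_fubiniStudy {R : ℝ} (hR : 0 < R) : CP11.IsSymplectic (fubiniStudy R) where
  smooth i A B := smoothOn_fubiniStudy R i A B
  even i A B x _ := hasParity_fubiniStudy R i x A B
  compat i j A' B' x hx := fubiniStudy_compat R i j A' B' x hx
  antisymm i A B x _ := fubiniStudy_antisymm R i x A B
  closed i A B C x _ := fubiniStudy_closed R i x A B C
  nondegenerate i x _ := fubiniStudy_nondegenerate hR i x

open MeasureTheory Filter Topology

/-! ### A partition of unity on `CP^{1|1}` -/

/-- The smooth function of `(1 - |w|²) / (1 + |w|²)` that is the first member of a partition of unity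
on the projective line. -/
noncomputable def cutoff (x : Fin 2 → ℝ) : ℝ :=
  Real.smoothTransition ((1 - x 0 ^ 2 - x 1 ^ 2) * fsWeight x + 1 / 2)

theorem contDiff_cutoff : ContDiff ℝ ∞ cutoff := by
  have h := contDiff_fsWeight
  exact (Real.smoothTransition.contDiff (n := ⊤)).comp (by fun_prop)

theorem smoothTransition_one_sub (t : ℝ) :
    Real.smoothTransition (1 - t) = 1 - Real.smoothTransition t := by
  have h := (Real.smoothTransition.pos_denom t).ne'
  rw [eq_sub_iff_add_eq, Real.smoothTransition, Real.smoothTransition, sub_sub_cancel,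
    add_comm (expNegInvGlue (1 - t)), ← add_div, add_comm, div_self h]

/-- Inversion changes the sign of the height `(1 - |w|²)/(1 + |w|²)`, hence sends the argument `t`
of the transition function to `1 - t`. -/
theorem cutoff_inversion {x : Fin 2 → ℝ} (hx : x ≠ 0) : cutoff (inversion x) = 1 - cutoff x := by
  rw [cutoff, cutoff, ← smoothTransition_one_sub, fsWeight_eq_mul_fsWeight_inversion hx]
  congr 1
  have e0 := inversion_zero_apply (inversion x)
  have e1 := inversion_one_apply (inversion x)
  rw [inversion_inversion] at e0 e1
  rw [e0, e1]
  have hn := sq_add_sq_ne_zero (inversion_ne_zero hx)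
  field_simp
  ring

/-- The bound 3 is the value of `|w|²` at which the height equals `-1/2`. -/
theorem cutoff_eq_zero {x : Fin 2 → ℝ} (hx : 3 ≤ x 0 ^ 2 + x 1 ^ 2) : cutoff x = 0 := by
  apply Real.smoothTransition.zero_of_nonpos
  have h := fsWeight_mul x
  nlinarith [mul_nonneg (sub_nonneg.2 hx) (fsWeight_pos x).le]

theorem cutoff_zero : cutoff 0 = 1 := by
  apply Real.smoothTransition.one_of_one_le
  norm_num [fsWeight]

theorem isCompact_disc : IsCompact {x : Fin 2 → ℝ | x 0 ^ 2 + x 1 ^ 2 ≤ 3} := by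
  refine Metric.isCompact_of_isClosed_isBounded (isClosed_le (by fun_prop) continuous_const) ?_
  refine (Metric.isBounded_closedBall (x := (0 : Fin 2 → ℝ)) (r := 2)).subset fun x hx => ?_
  rw [mem_closedBall_zero_iff, pi_norm_le_iff_of_nonneg (by norm_num)]
  have hx' : x 0 ^ 2 + x 1 ^ 2 ≤ 3 := hx
  intro i
  rw [Real.norm_eq_abs]
  fin_cases i
  · exact abs_le_of_sq_le_sq (by simp; nlinarith [sq_nonneg (x 1)]) (by norm_num)
  · exact abs_le_of_sq_le_sq (by simp; nlinarith [sq_nonneg (x 0)]) (by norm_num)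

/-- A partition of unity subordinate to the atlas of `CP^{1|1}`. -/
noncomputable def cpPartition (k i : Fin 2) (x : Fin 2 → ℝ) : Grassmann 2 :=
  gr (if k = i then cutoff x else 1 - cutoff x) 0 0 0

theorem isPartitionOfUnity_cpPartition : CP11.IsPartitionOfUnity cpPartition where
  isEvenFunction k :=
    { smooth := fun i => by
        have h : ContDiff ℝ ∞ fun x => if k = i then cutoff x else 1 - cutoff x := by
          split_ifs
          · exact contDiff_cutoff
          · exact contDiff_const.sub contDiff_cutoff
        exact smoothOn_gr h.contDiffOn contDiffOn_const contDiffOn_const contDiffOn_const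
      even := fun i x _ => hasParity_zero_gr _ _
      compat := fun i j x hx => by
        by_cases h : i = j
        · subst h
          rw [pullback_of_coordFun fun A => by rw [trans_self]]
        · rw [overlap_ne h] at hx
          rw [pullback_trans h (cpPartition k j) (x := x) rfl, cutoff_inversion hx, cpPartition]
          have : (k = i ∧ k ≠ j) ∨ (k ≠ i ∧ k = j) := by omega
          rcases this with ⟨h1, h2⟩ | ⟨h1, h2⟩
          · simp only [if_pos h1, if_neg h2, sub_sub_cancel, zero_mul, add_zero, sub_zero]
          · simp only [if_neg h1, if_pos h2, zero_mul, add_zero, sub_zero] }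
  support k := by
    refine ⟨{x | x 0 ^ 2 + x 1 ^ 2 ≤ 3}, Set.subset_univ _, isCompact_disc, fun i x _ hx => ?_⟩
    rw [cpPartition, zero_eq_gr]
    congr 1
    split_ifs with h
    · subst h
      refine cutoff_eq_zero (not_lt.1 fun hlt => hx ⟨x, hlt.le, rfl⟩)
    -- The origin of chart `i` lies outside chart `k`, so inversion is unavailable there; the cutoff
    -- equals 1 at that point.
    · by_cases hx0 : x = 0
      · rw [hx0, cutoff_zero, sub_self]
      · rw [← cutoff_inversion hx0]
        refine cutoff_eq_zero (not_lt.1 fun hlt => hx ⟨inversion x, hlt.le, ?_⟩)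
        refine (cpParam_eq_iff_ne h).2 (inv_mul_cancel₀ (toComplex_ne_zero.2 hx0))
  sum_eq_one i x _ := by
    rw [Fin.sum_univ_two, cpPartition, cpPartition, gr_add, one_eq_gr]
    fin_cases i <;> simp

/-! ### The Liouville volume -/

theorem liouvilleDensity_fubiniStudy {R : ℝ} (hR : 0 < R) (i : Fin 2) (x : Fin 2 → ℝ) :
    SuperAtlas.liouvilleDensity (fubiniStudy R) i x =
      gr (fsWeight x) 0 0 (-(2 * fsWeight x ^ 2)) := by
  have hq := fsWeight_pos x
  have hd : HasDerivAt (fun t : ℝ => √|t|) (1 / (2 * √(fsWeight x ^ 2))) (fsWeight x ^ 2) :=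
    (Real.hasDerivAt_sqrt (by positivity)).congr_of_eventuallyEq
      ((lt_mem_nhds (by positivity : 0 < fsWeight x ^ 2)).mono fun t ht => by
        simp only [abs_of_pos ht])
  rw [SuperAtlas.liouvilleDensity, ber_fubiniStudy hR, applyFun_gr, hd.deriv,
    abs_of_nonneg (by positivity), Real.sqrt_sq hq.le]
  congr 1
  field_simp
  ring

theorem berezin_mul_liouvilleDensity {R : ℝ} (hR : 0 < R) (i : Fin 2) (x : Fin 2 → ℝ)
    (a : Grassmann 2) :
    berezin (a * SuperAtlas.liouvilleDensity (fubiniStudy R) i x) =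
      2 * fsWeight x ^ 2 * coeff ∅ a - fsWeight x * coeff {0, 1} a := by
  conv_lhs => rw [eq_gr_coeff a]
  rw [liouvilleDensity_fubiniStudy hR, gr_mul, berezin_gr]
  ring

/-- The Berezin integral of a superfunction times the Liouville density, as a function of the
even coordinates. -/
noncomputable def liouvilleIntegrand (f : (Fin 2 → ℝ) → Grassmann 2) (x : Fin 2 → ℝ) : ℝ :=
  2 * fsWeight x ^ 2 * coeff ∅ (f x) - fsWeight x * coeff {0, 1} (f x)

/-- Both terms scale alike: `q²` contributes `|w'|⁴`, while in the other term `q` and the `ξη`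
coefficient contribute `|w'|²` each. -/
theorem liouvilleIntegrand_pullback {i j : Fin 2} (h : i ≠ j) {f g : (Fin 2 → ℝ) → Grassmann 2}
    {x : Fin 2 → ℝ} (hx : x ≠ 0) (hf : f x = pullback (CP11.trans i j) g x) :
    liouvilleIntegrand f x =
      (inversion x 0 ^ 2 + inversion x 1 ^ 2) ^ 2 * liouvilleIntegrand g (inversion x) := by
  rw [liouvilleIntegrand, hf, pullback_trans h g (eq_gr_coeff _), coeff_empty_gr, coeff_pair_gr,
    fsWeight_eq_mul_fsWeight_inversion hx, liouvilleIntegrand]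
  ring

/-! ### Change of variables by inversion -/

theorem hasFDerivAt_inversion {x : Fin 2 → ℝ} (hx : x ≠ 0) :
    ∃ f' : (Fin 2 → ℝ) →L[ℝ] (Fin 2 → ℝ), HasFDerivAt inversion f' x ∧
      |f'.det| = (inversion x 0 ^ 2 + inversion x 1 ^ 2) ^ 2 := by
  obtain ⟨h0, h1⟩ := hasGrad_inversion hx
  let e (i : Fin 2) := ContinuousLinearMap.proj (R := ℝ) (φ := fun _ : Fin 2 => ℝ) i
  refine ⟨ContinuousLinearMap.pi
    ![(inversion x 1 ^ 2 - inversion x 0 ^ 2) • e 0 + (2 * inversion x 0 * inversion x 1) • e 1,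
      -(2 * inversion x 0 * inversion x 1) • e 0 +
        (inversion x 1 ^ 2 - inversion x 0 ^ 2) • e 1], hasFDerivAt_pi.2 fun a => ?_, ?_⟩
  · fin_cases a
    · exact h0
    · exact h1
  · rw [ContinuousLinearMap.det, ← LinearMap.det_toMatrix', det_fin_two]
    simp [LinearMap.toMatrix'_apply, e]
    rw [← abs_of_nonneg (sq_nonneg (inversion x 0 ^ 2 + inversion x 1 ^ 2))]
    congr 1
    ring

theorem inversion_image : inversion '' {0}ᶜ = {0}ᶜ :=
  Set.Subset.antisymm (Set.image_subset_iff.2 fun _ hx => inversion_ne_zero hx)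
    fun x hx => ⟨inversion x, inversion_ne_zero hx, inversion_inversion x⟩

/-- Inversion is a bijection of the punctured plane, and the origin is a null set. -/
theorem integrable_and_integral_inversion {F G : (Fin 2 → ℝ) → ℝ} (hG : Integrable G)
    (h : ∀ x, x ≠ 0 → F x = (inversion x 0 ^ 2 + inversion x 1 ^ 2) ^ 2 * G (inversion x)) :
    Integrable F ∧ ∫ x, F x = ∫ x, G x := by
  have hd (x : Fin 2 → ℝ) : ∃ f' : (Fin 2 → ℝ) →L[ℝ] (Fin 2 → ℝ), x ≠ 0 →
      HasFDerivAt inversion f' x ∧ |f'.det| = (inversion x 0 ^ 2 + inversion x 1 ^ 2) ^ 2 := by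
    by_cases hx : x = 0
    · exact ⟨0, fun h => absurd hx h⟩
    · obtain ⟨f', h⟩ := hasFDerivAt_inversion hx
      exact ⟨f', fun _ => h⟩
  choose f' hf' using hd
  have hm : MeasurableSet ({0}ᶜ : Set (Fin 2 → ℝ)) := (measurableSet_singleton 0).compl
  have hinj : Set.InjOn inversion {0}ᶜ :=
    (Function.LeftInverse.injective inversion_inversion).injOn
  have hd' : ∀ x ∈ ({0}ᶜ : Set (Fin 2 → ℝ)), HasFDerivWithinAt inversion (f' x) {0}ᶜ x :=
    fun x hx => (hf' x hx).1.hasFDerivWithinAt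
  have he : Set.EqOn (fun x => |(f' x).det| • G (inversion x)) F {0}ᶜ := fun x hx => by
    simp only [(hf' x hx).2, h x hx, smul_eq_mul]
  have hr : (volume : Measure (Fin 2 → ℝ)).restrict {0}ᶜ = volume :=
    restrict_compl_singleton 0
  constructor
  · have := (integrableOn_image_iff_integrableOn_abs_det_fderiv_smul volume hm hd' hinj G).1
      (by rw [inversion_image, IntegrableOn, hr]; exact hG)
    rw [integrableOn_congr_fun he hm, IntegrableOn, hr] at this
    exact this
  · have := integral_image_eq_integral_abs_det_fderiv_smul volume hm hd' hinj G
    rw [inversion_image, setIntegral_congr_fun hm he, hr] at this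
    exact this.symm

theorem integral_fsWeight_sq : ∫ x, 2 * fsWeight x ^ 2 = 2 * Real.pi := by
  rw [← Complex.volume_preserving_equiv_pi.integral_comp' (fun x => 2 * fsWeight x ^ 2)]
  have h1 (z : ℂ) : 2 * fsWeight (Complex.measurableEquivPi z) ^ 2 =
      (fun r : ℝ => 2 * ((1 + r ^ 2)⁻¹) ^ 2) ‖z‖ := by
    simp [fsWeight, Complex.measurableEquivPi_apply, Complex.sq_norm, Complex.normSq_apply,
      ← pow_two, add_assoc]
  simp only [h1]
  rw [integral_fun_norm_addHaar volume fun r : ℝ => 2 * ((1 + r ^ 2)⁻¹) ^ 2]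
  -- In polar coordinates the radial integrand is `2y/(1 + y²)²`, with primitive `-1/(1 + y²)`; the
  -- right side is its limit at infinity minus its value at 0. The remaining factor is the dimension
  -- 2 times the area `π` of the unit disc.
  have h2 : ∫ y in Set.Ioi (0 : ℝ), y ^ (2 - 1) • (2 * ((1 + y ^ 2)⁻¹) ^ 2) = 0 - -(1 + 0 ^ 2)⁻¹ := by
    refine integral_Ioi_of_hasDerivAt_of_nonneg' (g := fun y : ℝ => -(1 + y ^ 2)⁻¹) (fun y _ => ?_)
      (fun y hy => ?_) ?_
    · have hy : 1 + y ^ 2 ≠ 0 := by positivity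
      refine ((((hasDerivAt_pow 2 y).const_add 1).inv hy).neg).congr_deriv ?_
      simp
      field_simp
    · have : (0 : ℝ) < y := hy
      positivity
    · rw [← neg_zero]
      exact (tendsto_inv_atTop_zero.comp (tendsto_atTop_add_const_left _ _
        (tendsto_pow_atTop two_ne_zero))).neg
  rw [Complex.finrank_real_complex, h2, measureReal_def, Complex.volume_ball]
  simp

theorem hasLiouvilleVolume_fubiniStudy {R : ℝ} (hR : 0 < R) :
    CP11.HasLiouvilleVolume (fubiniStudy R) (2 * Real.pi) := by
  refine ⟨⟨_, isPartitionOfUnity_cpPartition⟩, fun ρ hρ => ?_⟩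
  have hint (k : Fin 2) : Integrable (liouvilleIntegrand (ρ k k)) := by
    obtain ⟨K, -, hK, hz⟩ := hρ.support k
    have hc (I) : Continuous fun x => coeff I (ρ k k x) :=
      (contDiffOn_univ.1 ((hρ.isEvenFunction k).smooth k I)).continuous
    have hq := contDiff_fsWeight.continuous
    refine Continuous.integrable_of_hasCompactSupport ?_ (HasCompactSupport.intro hK fun x hx => ?_)
    · have h0 := hc ∅
      have h1 := hc {0, 1}
      unfold liouvilleIntegrand
      fun_prop
    · rw [liouvilleIntegrand, hz k x (Set.mem_univ _)]
      · simp
      · rintro ⟨y, hy, hyx⟩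
        exact hx (cpParam_eq_iff_same.1 hyx ▸ hy)
  -- The second member of the partition need not have compact support in the coordinates of chart 0;
  -- its integrability there is inherited from chart 1.
  obtain ⟨hi, he⟩ := integrable_and_integral_inversion (F := liouvilleIntegrand (ρ 1 0)) (hint 1)
    fun x hx => liouvilleIntegrand_pullback zero_ne_one hx
      ((hρ.isEvenFunction 1).compat 0 1 x (by rwa [overlap_ne zero_ne_one]))
  have hdom (k : Fin 2) : CP11.dom k = Set.univ := rfl
  simp only [berezin_mul_liouvilleDensity hR, hdom, Measure.restrict_univ, Fin.sum_univ_two]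
  change (∫ x, liouvilleIntegrand (ρ 0 0) x) + ∫ x, liouvilleIntegrand (ρ 1 1) x = _
  rw [← he, ← integral_add (hint 0) hi, ← integral_fsWeight_sq]
  refine integral_congr_ae (.of_forall fun x => ?_)
  -- Both coefficients matter: the bodies sum to 1, while the `ξη` terms, which the Berezin integral
  -- also sees, sum to 0.
  have hsum := hρ.sum_eq_one 0 x (Set.mem_univ _)
  rw [Fin.sum_univ_two, one_eq_gr] at hsum
  have h0 := congrArg (coeff ∅) hsum
  have h1 := congrArg (coeff {0, 1}) hsum
  rw [map_add, coeff_empty_gr] at h0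
  rw [map_add, coeff_pair_gr] at h1
  simp only [liouvilleIntegrand]
  linear_combination 2 * fsWeight x ^ 2 * h0 - fsWeight x * h1

theorem body_ber_fubiniStudy_pos {R : ℝ} (hR : 0 < R) (i : Fin 2) (x : Fin 2 → ℝ) :
    0 < body (ber (fubiniStudy R i x)) := by
  rw [ber_fubiniStudy hR, body_gr]
  exact pow_pos (fsWeight_pos x) 2

theorem not_liouvilleVolumesVanish : ¬ LiouvilleVolumesVanish := fun h =>
  (mul_pos two_pos Real.pi_pos).ne' <|
    h 2 2 CP1 (Fin 2) CP11 (fubiniStudy 1) _ two_pos isSupermanifold_CP11 isOriented_CP11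
      (isSymplectic_fubiniStudy one_pos) (hasLiouvilleVolume_fubiniStudy one_pos)

end Supergeometry

theorem mainTheorem4 :
    CompactSpace CP1 ∧ CP11.IsSupermanifold ∧ CP11.IsOriented ∧
    (∀ R : ℝ, 0 < R →
      CP11.IsSymplectic (fubiniStudy R) ∧
      (∀ i x, 0 < body (ber (fubiniStudy R i x))) ∧
      CP11.HasLiouvilleVolume (fubiniStudy R) (2 * Real.pi)) ∧
    ¬ LiouvilleVolumesVanish :=
  ⟨compactSpace_CP1, isSupermanifold_CP11, isOriented_CP11,
    fun _ hR => ⟨isSymplectic_fubiniStudy hR, body_ber_fubiniStudy_pos hR,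
      hasLiouvilleVolume_fubiniStudy hR⟩,
    not_liouvilleVolumesVanish⟩
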